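/- **Notation.** For integers $p\ge 1$, $n\ge 0$ and a root of unity $x\in\mathbb C$ put $$\zeta_n(p;x)=\sum_{k=1}^n\frac{x^k}{k^p},\qquad t_n(p;x)=\sum_{k=1}^n\frac{x^k}{(k-1/2)^p},$$ and, for $(p,x)\ne(1,1)$, $\mathrm{Li}_p(x)=\lim_n\zeta_n(p;x)$ and $\mathrm{ti}_p(x)=\lim_n t_n(p;x)$. For roots of unity $y_1,\dots,y_k,z$ and integers $p_1,\dots,p_k,q\ge1$ with $(q,z)\neq(1,1)$ put $$R_{p_1,\dots,p_k;q}(y_1,\dots,y_k;z)=\sum_{n=0}^\infty\frac{\prod_j\zeta_n(p_j;y_j)}{(n+1/2)^q}z^n,\qquad \tilde S_{p_1,\dots,p_k;q}(y_1,\dots,y_k;z)=\sum_{n=1}^\infty\frac{\prod_j t_n(p_j;y_j)}{n^q}z^n,$$ $$\mathrm{Ti}_{k_1,\dots,k_r}(y_1,\dots,y_r)=2^r\sum_{0<n_1<\cdots<n_r}\frac{y_1^{n_1}\cdots y_r^{n_r}}{(2n_1-1)^{k_1}(2n_2-2)^{k_2}\cdots(2n_r-r)^{k_r}},$$ infinite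 sums being limits of the partial sums ($n<N$, $n\le N$ and $n_r\le N$ respectively, $N\to\infty$). Put $$\Delta_k(x)=(-1)^k\mathrm{ti}_{k+1}(x)-x\,\mathrm{ti}_{k+1}(x^{-1}),\qquad \Lambda_k(x)=(-1)^k\mathrm{Li}_{k+1}(x)-\mathrm{Li}_{k+1}(x^{-1}),$$ with $\Delta_0(1)=\Lambda_0(1)=0$, and let $\sum_\sigma$ denote the sum over the two permutations $\sigma$ of $\{1,2\}$. **Theorem.** (0) Let $p,p',q\geq 1$ and let $y,y',z$ be roots of unity with $(p,y),(p',y'),(q,z)\ne(1,1)$. Then the series defining $\mathrm{Li}_p(y)$, $\mathrm{ti}_p(y)$, $R_{p;q}(y;z)$, $\tilde S_{p;q}(y;z)$, $\tilde S_{p,p';q}(y,y';z)$, $\mathrm{Ti}_{p,q}(y,z)$ and $\mathrm{Ti}_{p,q,p'}(y,z,y')$ converge. (1) Let $x,x_1,x_2$ be roots of unity, let $p_1,p_2,q\ge1$, and put $X=xx_1x_2$. Suppose $(p_1,x_1),(p_2,x_2),(q,X)\ne(1,1)$. Then $$(x_1x_2)^{-1}\tilde S_{p_1,p_2;q}(x_1,x_2;X^{-1})+(-1)^{p_1+p_2+q}\tilde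 S_{p_1,p_2;q}(x_1^{-1},x_2^{-1};X)=\mathcal R,$$ where $$\begin{aligned} \mathcal R={}&-(x_1x_2)^{-1}\mathrm{ti}_{p_1}(x_1)\mathrm{ti}_{p_2}(x_2)\mathrm{Li}_q(X^{-1})-(-1)^q(x_1x_2)^{-1}\mathrm{ti}_{p_1}(x_1)\mathrm{ti}_{p_2}(x_2)\mathrm{Li}_q(X)\\ &+\sum_{\sigma}(x_1x_2)^{-1}\mathrm{ti}_{p_{\sigma(1)}}(x_{\sigma(1)})\tilde S_{p_{\sigma(2)};q}(x_{\sigma(2)};X^{-1})\\ &-(-1)^q\sum_\sigma(-1)^{p_{\sigma(2)}}x_{\sigma(1)}^{-1}\mathrm{ti}_{p_{\sigma(1)}}(x_{\sigma(1)})\tilde S_{p_{\sigma(2)};q}(x_{\sigma(2)}^{-1};X)\\ &-(-1)^qX^{-1}\sum_{k=0}^{p_1+p_2-1}\binom{p_1+p_2+q-k-2}{q-1}\Delta_k(x)\,\mathrm{ti}_{p_1+p_2+q-k-1}(X)\\ &-(-1)^q\sum_\sigma\ \sum_{\substack{k_1,k_2\ge0\\k_1+k_2\le p_{\sigma(1)}-1}}\binom{p_{\sigma(1)}+q-k_1-k_2-2}{q-1}\binom{k_2+p_{\sigma(2)}-1}{p_{\sigma(2)}-1}\Delta_{k_1}(x)\\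 &\qquad\times\Big\{(-1)^{k_2}X^{-1}\mathrm{Li}_{k_2+p_{\sigma(2)}}(x_{\sigma(2)})\,\mathrm{ti}_{q+p_{\sigma(1)}-k_1-k_2-1}(X)\\ &\qquad\qquad+(-1)^{p_{\sigma(2)}}R_{k_2+p_{\sigma(2)};\,q+p_{\sigma(1)}-k_1-k_2-1}(x_{\sigma(2)}^{-1};X)\Big\}\\ &-(-1)^q\sum_{\substack{k_1+k_2=q\\k_1,k_2\ge0}}\binom{p_1+k_1-1}{p_1-1}\binom{p_2+k_2-1}{p_2-1}(x_1x_2)^{-1}\mathrm{ti}_{p_1+k_1}(x_1)\mathrm{ti}_{p_2+k_2}(x_2)\\ &-\sum_{\substack{k_1+k_2+k_3=q-1\\k_1,k_2,k_3\ge0}}\Lambda_{k_1}(x)(-1)^{k_2+k_3}\binom{k_2+p_1-1}{p_1-1}\binom{k_3+p_2-1}{p_2-1}\mathrm{ti}_{k_2+p_1}(x_1)\mathrm{ti}_{k_3+p_2}(x_2)(x_1x_2)^{-1}. \end{aligned}$$ (2) Let $p,q,r\geq 1$ and let $y,z,w$ be roots of unity. If $(p,y),(q,z)\ne(1,1)$,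 then $$\mathrm{Ti}_{p,q}(y,z)=\frac{z}{2^{p+q-2}}\tilde S_{p;q}(y;z).$$ If moreover $(r,w)\ne(1,1)$, then $$\mathrm{Ti}_{p,q,r}(y,z,w)=\frac{zw}{2^{p+q+r-3}}\big(\mathrm{ti}_r(w)\tilde S_{p;q}(y;z)-\tilde S_{p,r;q}(y,w;z)\big).$$ (3) Consequently, under the hypotheses of (1), triple $\mathrm{Ti}$-values satisfy the explicit parity formula $$\begin{aligned} &2^{p_1+p_2+q-3}\Big(x x_2^{-1}\,\mathrm{Ti}_{p_1,q,p_2}(x_1,X^{-1},x_2)+(-1)^{p_1+p_2+q}(xx_1)^{-1}\,\mathrm{Ti}_{p_1,q,p_2}(x_1^{-1},X,x_2^{-1})\Big)\\ &=2^{p_1+q-2}\Big(x\,\mathrm{ti}_{p_2}(x_2)\,\mathrm{Ti}_{p_1,q}(x_1,X^{-1})+(-1)^{p_1+p_2+q}X^{-1}\,\mathrm{ti}_{p_2}(x_2^{-1})\,\mathrm{Ti}_{p_1,q}(x_1^{-1},X)\Big)-\mathcal R. \end{aligned}$$ -/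

import Mathlib

open Filter Topology Finset

noncomputable section

namespace CyclotomicEuler

/-- A sequence of (partial sums of) complex numbers converges. -/
def Converges (u : ℕ → ℂ) : Prop := ∃ L : ℂ, Tendsto u atTop (𝓝 L)

/-- `p ≥ 1`, `x` is a root of unity, and `(p, x) ≠ (1, 1)`. -/
def Admissible (p : ℕ) (x : ℂ) : Prop :=
  1 ≤ p ∧ IsOfFinOrder x ∧ (p, x) ≠ (1, 1)

/-- `ζ_n(p; x) = ∑_{k=1}^n x^k / k^p`. -/
def zetaN (p : ℕ) (x : ℂ) (n : ℕ) : ℂ := ∑ k ∈ Icc 1 n, x ^ k / (k : ℂ) ^ p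

/-- `t_n(p; x) = ∑_{k=1}^n x^k / (k - 1/2)^p`. -/
def tN (p : ℕ) (x : ℂ) (n : ℕ) : ℂ := ∑ k ∈ Icc 1 n, x ^ k / ((k : ℂ) - 1 / 2) ^ p

/-- The polylogarithm `Li_p(x) = lim ζ_n(p; x)`. (For `(p, x) = (1, 1)` the series diverges and the
value is meaningless.) -/
def Li (p : ℕ) (x : ℂ) : ℂ := limUnder atTop (zetaN p x)

/-- The `t`-polylogarithm `ti_p(x) = lim t_n(p; x)`. (For `(p, x) = (1, 1)` the series diverges and
the value is meaningless.) -/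
def ti (p : ℕ) (x : ℂ) : ℂ := limUnder atTop (tN p x)

/-- Partial sums, over `0 ≤ n < N`, of the cyclotomic Euler `R`-sum. -/
def eulerRPartial {k : ℕ} (p : Fin k → ℕ) (q : ℕ) (x : Fin k → ℂ) (z : ℂ) (N : ℕ) : ℂ :=
  ∑ n ∈ range N, (∏ j, zetaN (p j) (x j) n) / ((n : ℂ) + 1 / 2) ^ q * z ^ n

/-- The cyclotomic Euler `R`-sum
`R_{p_1,…,p_k;q}(x_1,…,x_k;z) = ∑_{n ≥ 0} ζ_n(p_1;x_1)⋯ζ_n(p_k;x_k) / (n + 1/2)^q * z^n`. -/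
def eulerR {k : ℕ} (p : Fin k → ℕ) (q : ℕ) (x : Fin k → ℂ) (z : ℂ) : ℂ :=
  limUnder atTop (eulerRPartial p q x z)

/-- Partial sums, over `1 ≤ n ≤ N`, of the cyclotomic Euler `S̃`-sum. -/
def eulerSPartial {k : ℕ} (p : Fin k → ℕ) (q : ℕ) (x : Fin k → ℂ) (z : ℂ) (N : ℕ) : ℂ :=
  ∑ n ∈ Icc 1 N, (∏ j, tN (p j) (x j) n) / (n : ℂ) ^ q * z ^ n

/-- The cyclotomic Euler `S̃`-sum
`S̃_{p_1,…,p_k;q}(x_1,…,x_k;z) = ∑_{n ≥ 1} t_n(p_1;x_1)⋯t_n(p_k;x_k) / n^q * z^n`. -/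
def eulerS {k : ℕ} (p : Fin k → ℕ) (q : ℕ) (x : Fin k → ℂ) (z : ℂ) : ℂ :=
  limUnder atTop (eulerSPartial p q x z)

open Classical in
/-- Partial sums, over `0 < n_1 < ⋯ < n_r ≤ N`, of the cyclotomic multiple `T`-value. The index
`i : Fin r` starts at `0`, so that the `i`-th denominator is `2 n_i - (i + 1)`. -/
def multipleTPartial {r : ℕ} (k : Fin r → ℕ) (x : Fin r → ℂ) (N : ℕ) : ℂ :=
  2 ^ r * ∑ n ∈ (Fintype.piFinset fun _ : Fin r => Icc 1 N).filter (fun n => StrictMono n),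
    ∏ i, x i ^ n i / (2 * (n i : ℂ) - ((i : ℕ) + 1 : ℂ)) ^ k i

/-- The cyclotomic multiple `T`-value
`Ti_{k_1,…,k_r}(x_1,…,x_r) = 2^r ∑_{0 < n_1 < ⋯ < n_r} ∏_j x_j^{n_j} / (2 n_j - j)^{k_j}`. -/
def multipleT {r : ℕ} (k : Fin r → ℕ) (x : Fin r → ℂ) : ℂ :=
  limUnder atTop (multipleTPartial k x)

/-- The sum over both orderings of the pairs `(p₁, x₁)`, `(p₂, x₂)`. -/
def sumSwap (f : ℕ → ℂ → ℕ → ℂ → ℂ) (p₁ : ℕ) (x₁ : ℂ) (p₂ : ℕ) (x₂ : ℂ) : ℂ :=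
  f p₁ x₁ p₂ x₂ + f p₂ x₂ p₁ x₁

/-- `(-1)^k ti_{k+1}(x) - x ti_{k+1}(x⁻¹)`; for `k = 0` and `x = 1` this is `0`, the two (then
meaningless) terms being equal. -/
def tiDiff (k : ℕ) (x : ℂ) : ℂ := (-1) ^ k * ti (k + 1) x - x * ti (k + 1) x⁻¹

/-- `(-1)^k Li_{k+1}(x) - Li_{k+1}(x⁻¹)`; for `k = 0` and `x = 1` this is `0`, the two (then
meaningless) terms being equal. -/
def LiDiff (k : ℕ) (x : ℂ) : ℂ := (-1) ^ k * Li (k + 1) x - Li (k + 1) x⁻¹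

theorem tiDiff_zero_one : tiDiff 0 1 = 0 := by simp [tiDiff]

theorem LiDiff_zero_one : LiDiff 0 1 = 0 := by simp [LiDiff]

/-- The right-hand side of the parity formula for quadratic `S̃`-sums: a combination of linear
`S̃`-sums, linear `R`-sums and products of values of `Li` and `ti`. -/
def parityRHS (p₁ p₂ q : ℕ) (x x₁ x₂ : ℂ) : ℂ :=
  - (x₁ * x₂)⁻¹ * ti p₁ x₁ * ti p₂ x₂ * Li q (x * x₁ * x₂)⁻¹
  - (-1) ^ q * (x₁ * x₂)⁻¹ * ti p₁ x₁ * ti p₂ x₂ * Li q (x * x₁ * x₂)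
  + sumSwap (fun a y b w =>
      (x₁ * x₂)⁻¹ * ti a y * eulerS ![b] q ![w] (x * x₁ * x₂)⁻¹) p₁ x₁ p₂ x₂
  - (-1) ^ q * sumSwap (fun a y b w =>
      (-1) ^ b * y⁻¹ * ti a y * eulerS ![b] q ![w⁻¹] (x * x₁ * x₂)) p₁ x₁ p₂ x₂
  - (-1) ^ q * (x * x₁ * x₂)⁻¹ * ∑ k ∈ range (p₁ + p₂),
      ((p₁ + p₂ + q - k - 2).choose (q - 1) : ℂ) * tiDiff k x
        * ti (p₁ + p₂ + q - k - 1) (x * x₁ * x₂)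
  - (-1) ^ q * sumSwap (fun a _ b w =>
      ∑ k₁ ∈ range a, ∑ k₂ ∈ range (a - k₁),
        ((a + q - k₁ - k₂ - 2).choose (q - 1) : ℂ) * ((k₂ + b - 1).choose (b - 1) : ℂ)
          * tiDiff k₁ x
          * ((-1) ^ k₂ * (x * x₁ * x₂)⁻¹ * Li (k₂ + b) w
                * ti (q + a - k₁ - k₂ - 1) (x * x₁ * x₂)
              + (-1) ^ b * eulerR ![k₂ + b] (q + a - k₁ - k₂ - 1) ![w⁻¹] (x * x₁ * x₂)))
      p₁ x₁ p₂ x₂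
  - ∑ k ∈ antidiagonal q,
      (-1) ^ q * ((p₁ + k.1 - 1).choose (p₁ - 1) : ℂ) * ((p₂ + k.2 - 1).choose (p₂ - 1) : ℂ)
        * (x₁ * x₂)⁻¹ * ti (p₁ + k.1) x₁ * ti (p₂ + k.2) x₂
  - ∑ k ∈ antidiagonal (q - 1), ∑ l ∈ antidiagonal k.2,
      LiDiff k.1 x * (-1) ^ (l.1 + l.2)
        * ((l.1 + p₁ - 1).choose (p₁ - 1) : ℂ) * ((l.2 + p₂ - 1).choose (p₂ - 1) : ℂ)
        * ti (l.1 + p₁) x₁ * ti (l.2 + p₂) x₂ * (x₁ * x₂)⁻¹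

end CyclotomicEuler

end

open CyclotomicEuler

namespace CyclotomicEuler

/-! The parity formula comes from evaluating one bilateral sum in two ways. With `windowSum p y M
n`, the sum of `y ^ a / (n + a - 1/2) ^ p` over `1 ≤ a ≤ M`, consider for each `M` the symmetric sum
over nonzero integers `n` of `x ^ (-n) / n ^ q` times the windows of `(p₁, x₁)` and `(p₂, x₂)`, and
let `M` tend to infinity.

First evaluation. For `n > 0` a window tends to `y ^ (-n) * (ti p y - tN p y n)`. For `n = -m < 0`
it tends to `y ^ m * (ti p y + (-1) ^ p * y * tN p y⁻¹ m)`, because reflecting the negative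
half-integers inverts `y`. Multiplying out and summing over `n` gives both quadratic sums of the
formula, plus linear sums and products (`tendsto_bilateralValue`).

Second evaluation. For fixed `M` the windows are finite, so the bilateral sum is a double sum over
`a`, `b` of sums over `n` of a rational function with poles at `1/2 - a`, `1/2 - b` and `0`. Partial
fractions reduce each of these to the elementary bilateral sums `tiDiff` and `LiDiff`
(`tendsto_bilateralSum_two_poles`); this plays the role of a residue computation. Summed over `a`
and `b`, the pole at `0` gives products of `ti`-values, the coinciding poles `a = b` give values of
`ti` at `X = x * x₁ * x₂`, and the poles with `a ≠ b` give products of `Li` and `ti` together with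
linear `R`-sums. The two evaluations meet in `bilateralValue_eq`.

The delicate point is convergence: exponents equal to `1` are allowed, so the series may converge
only conditionally. Every admissible series has tails `O(1/n)` (`Slow.exists_hasRate`), and the
limits can be handled because the sum of `1 / (n * (|M - n| + 1))` over `n` tends to `0` with `M`
(`exists_tendsto_zero_sum_le`).

The `T`-values reduce to these sums by shifting the summation indices, already at the level of
partial sums. -/

theorem sum_Icc_one {A : Type*} [AddCommMonoid A] (f : ℕ → A) (n : ℕ) :
    ∑ k ∈ Icc 1 n, f k = ∑ k ∈ range n, f (k + 1) := by
  induction n with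
  | zero => simp
  | succ n ih => rw [sum_Icc_succ_top (by omega), ih, sum_range_succ]

theorem sum_range_choose_add (a n : ℕ) :
    ∑ i ∈ range (n + 1), (a + i).choose a = (a + 1 + n).choose (a + 1) := by
  induction n with
  | zero => simp
  | succ n ih =>
    rw [sum_range_succ, ih, ← add_assoc (a + 1), Nat.choose_succ_succ' (a + 1 + n) a, add_comm]
    congr 2; omega

/-! ### Partial fractions for two poles. -/

section PartialFractions

variable {R : Type*} [CommRing R] {u v e : R}

/-- Only the relation between `u`, `v` and `e` is used, so any commutative ring is allowed. Over the
complex numbers this splits the summands; over power series it yields identities between Taylor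
coefficients. -/
theorem mul_pow_of_mul_eq (h : u * v = e * (u - v)) (m : ℕ) :
    u * v ^ (m + 1) = e ^ (m + 1) * u - ∑ l ∈ range (m + 1), e ^ (l + 1) * v ^ (m + 1 - l) := by
  induction m with
  | zero => simp; rw [h]; ring
  | succ m ih =>
    have h1 : ∑ l ∈ range (m + 1), e ^ (l + 1) * v ^ (m + 1 + 1 - l)
        = (∑ l ∈ range (m + 1), e ^ (l + 1) * v ^ (m + 1 - l)) * v := by
      rw [sum_mul]
      refine sum_congr rfl fun l hl => ?_
      rw [mem_range] at hl
      rw [show m + 1 + 1 - l = (m + 1 - l) + 1 by omega]; ring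
    rw [sum_range_succ, h1, pow_succ v (m + 1), ← mul_assoc, ih, show m + 1 + 1 - (m + 1) = 1 by omega]
    linear_combination e ^ (m + 1) * h

/-- Partial fractions for two poles, with `u = 1 / h`, `v = 1 / g` and `e = 1 / (g - h)`. -/
theorem pow_mul_pow_of_mul_eq (h : u * v = e * (u - v)) (P Q : ℕ) :
    u ^ (P + 1) * v ^ (Q + 1) =
      ∑ i ∈ range (P + 1), (-1) ^ i * ((Q + i).choose Q : R) * e ^ (Q + 1 + i) * u ^ (P + 1 - i)
      + ∑ i ∈ range (Q + 1),
          (-1) ^ i * ((P + i).choose P : R) * (-e) ^ (P + 1 + i) * v ^ (Q + 1 - i) := by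
  induction P with
  | zero =>
    rw [zero_add, pow_one, mul_pow_of_mul_eq h Q, sub_eq_add_neg, ← sum_neg_distrib]
    congr 1
    · simp
    · refine sum_congr rfl fun i _ => ?_
      rw [add_comm 1 i, neg_pow e]
      have : ((-1 : R) ^ i) * (-1) ^ (i + 1) = -1 := by
        rw [pow_succ, ← mul_assoc, ← mul_pow]; simp
      simp only [Nat.choose_zero_right, Nat.cast_one, mul_one]
      linear_combination (-e ^ (i + 1) * v ^ (Q + 1 - i)) * this
  | succ P ih =>
    have hs : ∀ i, ((-1 : R) ^ i) * (-e) ^ (P + 1 + i) = (-1) ^ (P + 1) * e ^ (P + 1 + i) := by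
      intro i
      rw [neg_pow e, pow_add (-1 : R) (P + 1) i]
      have : ((-1 : R) ^ i) * (-1) ^ i = 1 := by rw [← mul_pow]; simp
      linear_combination ((-1) ^ (P + 1) * e ^ (P + 1 + i)) * this
    have hs' : ∀ i, ((-1 : R) ^ i) * (-e) ^ (P + 1 + 1 + i) = (-1) ^ (P + 2) * e ^ (P + 2 + i) := by
      intro i
      rw [neg_pow e, pow_add (-1 : R) (P + 1 + 1) i]
      have : ((-1 : R) ^ i) * (-1) ^ i = 1 := by rw [← mul_pow]; simp
      linear_combination ((-1) ^ (P + 2) * e ^ (P + 2 + i)) * this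
    -- Each `u * v ^ (Q + 1 - i)` is expanded again. The resulting multiples of `u` add up, by the
    -- hockey-stick identity, to the new lowest power of `u`; the powers of `v` are regrouped along
    -- `s = i + l`, where the same identity gives the new binomials.
    have hv : ∑ i ∈ range (Q + 1), (-1) ^ i * ((P + i).choose P : R) * (-e) ^ (P + 1 + i)
          * (u * v ^ (Q + 1 - i))
        = (-1) ^ (P + 1) * e ^ (P + Q + 2) * ((P + 1 + Q).choose (P + 1) : R) * u
          + ∑ i ∈ range (Q + 1), (-1) ^ i * ((P + 1 + i).choose (P + 1) : R)
            * (-e) ^ (P + 1 + 1 + i) * v ^ (Q + 1 - i) := by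
      have h1 : ∀ i ∈ range (Q + 1), (-1) ^ i * ((P + i).choose P : R) * (-e) ^ (P + 1 + i)
          * (u * v ^ (Q + 1 - i))
          = (-1) ^ (P + 1) * e ^ (P + Q + 2) * ((P + i).choose P : R) * u
           + ∑ l ∈ range (Q + 1 - i),
            (-1) ^ (P + 2) * ((P + i).choose P : R) * e ^ (P + 2 + (i + l)) * v ^ (Q + 1 - (i + l)) := by
        intro i hi
        rw [mem_range] at hi
        obtain ⟨m, rfl⟩ : ∃ m, Q = i + m := ⟨Q - i, by omega⟩
        rw [show i + m + 1 - i = m + 1 by omega, mul_pow_of_mul_eq h m,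
          mul_right_comm ((-1 : R) ^ i), hs, mul_sub,
          sub_eq_add_neg, mul_sum, ← sum_neg_distrib]
        congr 1
        · ring
        · refine sum_congr rfl fun l hl => ?_
          rw [show i + m + 1 - (i + l) = m + 1 - l by omega]; ring
      rw [sum_congr rfl h1, sum_add_distrib]
      congr 1
      · rw [← sum_range_choose_add, Nat.cast_sum, mul_sum, sum_mul]
      · rw [← sum_range_diag_flip (Q + 1) (fun i l => (-1) ^ (P + 2) * ((P + i).choose P : R)
          * e ^ (P + 2 + (i + l)) * v ^ (Q + 1 - (i + l)))]
        refine sum_congr rfl fun s _ => ?_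
        rw [← sum_range_choose_add, mul_right_comm ((-1 : R) ^ s), hs', Nat.cast_sum, mul_sum, sum_mul]
        refine sum_congr rfl fun i hi => ?_
        rw [mem_range] at hi
        rw [show i + (s - i) = s by omega]; ring
    rw [pow_succ u (P + 1), mul_comm _ u, mul_assoc, ih, mul_add, mul_sum, mul_sum,
      sum_congr rfl (fun i _ => mul_left_comm u _ _), sum_congr (g := fun i => (-1) ^ i *
        ((P + i).choose P : R) * (-e) ^ (P + 1 + i) * (u * v ^ (Q + 1 - i))) rfl
        (fun i _ => mul_left_comm u _ _), hv, sum_range_succ _ (P + 1), ← add_assoc]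
    congr 2
    · refine sum_congr rfl fun i hi => ?_
      rw [mem_range] at hi
      rw [show P + 1 + 1 - i = (P + 1 - i) + 1 by omega]; ring
    · rw [show (P + 1 + Q).choose (P + 1) = (Q + (P + 1)).choose Q by
        rw [add_comm, Nat.choose_symm_add], show P + 1 + 1 - (P + 1) = 1 by omega]
      ring

end PartialFractions

/-! ### Taylor coefficients of products of inverse powers. -/

section Taylor
open PowerSeries

/-- The Taylor coefficients at `0` of `1 / (X + α) ^ (J + 1)`, in terms of `c = 1 / α`. -/
noncomputable def invPowCoeff (c : ℂ) (J m : ℕ) : ℂ :=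
  (-1) ^ m * ((J + m).choose J : ℂ) * c ^ (J + 1 + m)

/-- The power series of `1 / (X + α)`, in terms of `c = 1 / α`. -/
noncomputable def invSeries (c : ℂ) : ℂ⟦X⟧ := C c * rescale (-c) (mk 1)

theorem coeff_invSeries_pow (c : ℂ) (J m : ℕ) :
    coeff m (invSeries c ^ (J + 1)) = invPowCoeff c J m := by
  rw [invSeries, mul_pow, ← map_pow, ← map_pow, mk_one_pow_eq_mk_choose_add, coeff_C_mul,
    coeff_rescale, coeff_mk, invPowCoeff, neg_pow c]
  ring

theorem invSeries_mul {c : ℂ} (hc : c ≠ 0) : invSeries c * (X + C c⁻¹) = 1 := by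
  have h : (mk 1 : ℂ⟦X⟧) * (1 - X) = 1 := mk_one_mul_one_sub_eq_one ℂ
  have h2 := congrArg (rescale (-c)) h
  simp only [map_mul, map_sub, map_one, rescale_X] at h2
  have hC : (C c : ℂ⟦X⟧) * C c⁻¹ = 1 := by rw [← map_mul, mul_inv_cancel₀ hc, map_one]
  rw [invSeries]
  rw [map_neg] at h2
  linear_combination h2 + (rescale (-c) (mk 1) : ℂ⟦X⟧) * hC

/-- The Taylor coefficients of a product of two inverse powers with distinct poles, computed from
partial fractions. -/
theorem sum_invPowCoeff {α β : ℂ} (hα : α ≠ 0) (hβ : β ≠ 0) (h : α ≠ β) (P Q m : ℕ) :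
    ∑ i ∈ range (P + 1), (-1) ^ i * ((Q + i).choose Q : ℂ) * (β - α)⁻¹ ^ (Q + 1 + i)
        * invPowCoeff α⁻¹ (P - i) m
      + ∑ i ∈ range (Q + 1), (-1) ^ i * ((P + i).choose P : ℂ) * (α - β)⁻¹ ^ (P + 1 + i)
        * invPowCoeff β⁻¹ (Q - i) m
    = ∑ k ∈ antidiagonal m, invPowCoeff α⁻¹ P k.1 * invPowCoeff β⁻¹ Q k.2 := by
  have hU := invSeries_mul (inv_ne_zero hα)
  have hV := invSeries_mul (inv_ne_zero hβ)
  have hC : (C (β - α)⁻¹ : ℂ⟦X⟧) * (C β - C α) = 1 := by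
    rw [← map_sub, ← map_mul, inv_mul_cancel₀ (sub_ne_zero.2 h.symm), map_one]
  rw [inv_inv] at hU hV
  -- Multiplying by `X + α` and `X + β` shows that the two series satisfy the hypothesis of the
  -- partial fraction identity, now over `ℂ⟦X⟧`.
  have key : invSeries α⁻¹ * invSeries β⁻¹ = C (β - α)⁻¹ * (invSeries α⁻¹ - invSeries β⁻¹) := by
    linear_combination (-invSeries α⁻¹ * invSeries β⁻¹) * hC
      - (C (β - α)⁻¹ * invSeries β⁻¹) * hU + (C (β - α)⁻¹ * invSeries α⁻¹) * hV
  have := congrArg (coeff m) (pow_mul_pow_of_mul_eq key P Q)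
  simp_rw [coeff_mul, coeff_invSeries_pow] at this
  rw [this, map_add, map_sum, map_sum]
  congr 1
  · refine sum_congr rfl fun i hi => ?_
    rw [mem_range] at hi
    rw [show P + 1 - i = P - i + 1 by omega, ← coeff_invSeries_pow, ← coeff_C_mul]
    simp only [map_mul, map_pow, map_neg, map_one, map_natCast]
  · refine sum_congr rfl fun i hi => ?_
    rw [mem_range] at hi
    rw [show Q + 1 - i = Q - i + 1 by omega, ← coeff_invSeries_pow, ← coeff_C_mul,
      show (α - β)⁻¹ = -(β - α)⁻¹ by rw [← neg_sub, inv_neg]]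
    simp only [map_mul, map_pow, map_neg, map_one, map_natCast]

theorem sum_invPowCoeff_self (c : ℂ) (P Q m : ℕ) :
    ∑ k ∈ antidiagonal m, invPowCoeff c P k.1 * invPowCoeff c Q k.2
      = invPowCoeff c (P + Q + 1) m := by
  rw [← coeff_invSeries_pow, show P + Q + 1 + 1 = (P + 1) + (Q + 1) by ring, pow_add, coeff_mul]
  simp_rw [coeff_invSeries_pow]

end Taylor

/-! ### Convergence with rate `O(1 / n)`. -/

/-- `u` converges to `L` with error `O(1 / n)`. -/
def HasRate (u : ℕ → ℂ) (L : ℂ) : Prop := ∃ C : ℝ, ∀ n, ‖u n - L‖ ≤ C / (n + 1)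

/-- A bounded sequence with increments `O(1 / n)`. -/
def Slow (g : ℕ → ℂ) : Prop := ∃ C : ℝ, ∀ k, ‖g k‖ ≤ C ∧ ‖g (k + 1) - g k‖ ≤ C / (k + 1)

theorem tendsto_const_div_succ (C : ℝ) : Tendsto (fun n : ℕ => C / ((n : ℝ) + 1)) atTop (𝓝 0) := by
  simpa [div_eq_mul_inv] using
    (tendsto_one_div_add_atTop_nhds_zero_nat (𝕜 := ℝ)).const_mul C

theorem HasRate.tendsto {u : ℕ → ℂ} {L : ℂ} (h : HasRate u L) : Tendsto u atTop (𝓝 L) := by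
  obtain ⟨C, hC⟩ := h
  rw [tendsto_iff_norm_sub_tendsto_zero]
  exact squeeze_zero (fun _ => norm_nonneg _) hC (tendsto_const_div_succ C)

theorem HasRate.add {u v : ℕ → ℂ} {L M : ℂ} (hu : HasRate u L) (hv : HasRate v M) :
    HasRate (fun n => u n + v n) (L + M) := by
  obtain ⟨C, hC⟩ := hu
  obtain ⟨D, hD⟩ := hv
  refine ⟨C + D, fun n => ?_⟩
  rw [show u n + v n - (L + M) = (u n - L) + (v n - M) by ring, add_div]
  exact (norm_add_le _ _).trans (add_le_add (hC n) (hD n))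

theorem HasRate.const_mul {u : ℕ → ℂ} {L : ℂ} (c : ℂ) (hu : HasRate u L) :
    HasRate (fun n => c * u n) (c * L) := by
  obtain ⟨C, hC⟩ := hu
  refine ⟨‖c‖ * C, fun n => ?_⟩
  rw [← mul_sub, norm_mul, mul_div_assoc]
  exact mul_le_mul_of_nonneg_left (hC n) (norm_nonneg c)

theorem hasRate_const (L : ℂ) : HasRate (fun _ => L) L := ⟨0, fun n => by simp⟩

theorem exists_hasRate_of_forall_le {u : ℕ → ℂ} {C : ℝ}
    (h : ∀ n m, n ≤ m → ‖u m - u n‖ ≤ C / (n + 1)) : ∃ L, HasRate u L := by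
  have hc : CauchySeq u := by
    refine cauchySeq_of_le_tendsto_0 (fun N => C / ((N : ℝ) + 1) + C / ((N : ℝ) + 1)) ?_ ?_
    · intro n m N hn hm
      rw [dist_eq_norm, show u n - u m = (u n - u N) - (u m - u N) by ring]
      exact (norm_sub_le _ _).trans (add_le_add (h N n hn) (h N m hm))
    · simpa using (tendsto_const_div_succ C).add (tendsto_const_div_succ C)
  obtain ⟨L, hL⟩ := cauchySeq_tendsto_of_complete hc
  refine ⟨L, C, fun n => ?_⟩
  rw [norm_sub_rev]
  refine le_of_tendsto ((hL.sub_const (u n)).norm) ?_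
  filter_upwards [eventually_ge_atTop n] with m hm using h n m hm

theorem exists_hasRate_sum {f : ℕ → ℂ} {C : ℝ} (hf : ∀ k, ‖f k‖ ≤ C / ((k : ℝ) + 1) ^ 2) :
    ∃ L, HasRate (fun n => ∑ k ∈ range n, f k) L := by
  have hC : 0 ≤ C := by simpa using (norm_nonneg _).trans (hf 0)
  refine exists_hasRate_of_forall_le (C := 2 * C) fun n m hnm => ?_
  have key : ‖∑ k ∈ range m, f k - ∑ k ∈ range n, f k‖
      ≤ 2 * C / ((n : ℝ) + 1) - 2 * C / ((m : ℝ) + 1) := by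
    induction m, hnm using Nat.le_induction with
    | base => simp
    | succ m hnm ih =>
      rw [sum_range_succ, add_sub_right_comm]
      refine (norm_add_le _ _).trans ?_
      -- Telescoping majorant; the factor `2` comes from `m + 2 ≤ 2 * (m + 1)`.
      have h1 : C / ((m : ℝ) + 1) ^ 2 ≤ 2 * C / ((m : ℝ) + 1) - 2 * C / ((m : ℝ) + 1 + 1) := by
        have hm : (0 : ℝ) < (m : ℝ) + 1 := by positivity
        rw [div_sub_div _ _ (by positivity) (by positivity), div_le_div_iff₀ (by positivity)
          (by positivity)]
        have : 0 ≤ C * (m : ℝ) * (m + 1) ^ 2 := by positivity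
        nlinarith [this]
      push_cast
      linarith [hf m]
  refine key.trans (sub_le_self _ (by positivity))

/-- Summation by parts: `(1 - z) * ∑ z ^ k * g k = g 0 - z ^ n * g n + ∑ z ^ (k + 1) * (g (k + 1) -
g k)`, sums over `k < n`, and the last series converges absolutely. -/
theorem exists_hasRate_sum_pow_mul {g : ℕ → ℂ} {C : ℝ} {z : ℂ} (hz : ‖z‖ = 1) (hz1 : z ≠ 1)
    (hg : ∀ k, ‖g k‖ ≤ C / ((k : ℝ) + 1))
    (hg' : ∀ k, ‖g (k + 1) - g k‖ ≤ C / ((k : ℝ) + 1) ^ 2) :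
    ∃ L, HasRate (fun n => ∑ k ∈ range n, z ^ k * g k) L := by
  obtain ⟨L, hL⟩ := exists_hasRate_sum (f := fun k => z ^ (k + 1) * (g (k + 1) - g k)) (C := C)
    (fun k => by simpa [hz] using hg' k)
  have h0 : HasRate (fun n => -(z ^ n * g n)) 0 :=
    ⟨C, fun n => by simpa [hz] using hg n⟩
  refine ⟨(1 - z)⁻¹ * (g 0 + 0 + L), ?_⟩
  have h := (((hasRate_const (g 0)).add h0).add hL).const_mul (1 - z)⁻¹
  convert h using 2 with n
  rw [eq_inv_mul_iff_mul_eq₀ (sub_ne_zero.2 hz1.symm)]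
  induction n with
  | zero => simp
  | succ n ih =>
    rw [sum_range_succ, sum_range_succ, mul_add, ih]; ring

theorem Slow.mul {g h : ℕ → ℂ} (hg : Slow g) (hh : Slow h) : Slow (fun k => g k * h k) := by
  obtain ⟨C, hC⟩ := hg
  obtain ⟨D, hD⟩ := hh
  have hC0 : 0 ≤ C := (norm_nonneg _).trans (hC 0).1
  have hD0 : 0 ≤ D := (norm_nonneg _).trans (hD 0).1
  refine ⟨2 * (C * D), fun k => ⟨?_, ?_⟩⟩
  · rw [norm_mul]
    have := mul_le_mul (hC k).1 (hD k).1 (norm_nonneg _) hC0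
    nlinarith [mul_nonneg hC0 hD0]
  · rw [show g (k + 1) * h (k + 1) - g k * h k
      = (g (k + 1) - g k) * h (k + 1) + g k * (h (k + 1) - h k) by ring]
    refine (norm_add_le _ _).trans ?_
    rw [norm_mul, norm_mul]
    have h1 := mul_le_mul (hC k).2 (hD (k + 1)).1 (norm_nonneg _) (by positivity)
    have h2 := mul_le_mul (hC k).1 (hD k).2 (norm_nonneg _) hC0
    refine (add_le_add h1 h2).trans (le_of_eq ?_)
    ring

theorem slow_const (c : ℂ) : Slow (fun _ => c) := ⟨‖c‖, fun k => ⟨le_rfl, by simp; positivity⟩⟩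

theorem Slow.shift {g : ℕ → ℂ} (hg : Slow g) : Slow (fun k => g (k + 1)) := by
  obtain ⟨C, hC⟩ := hg
  have hC0 : 0 ≤ C := (norm_nonneg _).trans (hC 0).1
  refine ⟨C, fun k => ⟨(hC (k + 1)).1, (hC (k + 1)).2.trans ?_⟩⟩
  push_cast
  gcongr
  linarith

/-- The shifts needed are `s = 1/2` and `s = 1`; for both, `k + s ≥ (k + 1) / 2`. -/
theorem norm_inv_add_le {s : ℝ} (hs : 1 / 2 ≤ s) (k : ℕ) :
    ‖((k : ℂ) + s)⁻¹‖ ≤ 2 / ((k : ℝ) + 1) := by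
  rw [norm_inv, ← Complex.ofReal_natCast, ← Complex.ofReal_add, Complex.norm_real,
    Real.norm_of_nonneg (by positivity), inv_le_comm₀ (by positivity) (by positivity), inv_div]
  linarith [(Nat.cast_nonneg k : (0 : ℝ) ≤ k)]

theorem natCast_add_ne_zero {s : ℝ} (hs : 1 / 2 ≤ s) (k : ℕ) : (k : ℂ) + s ≠ 0 := by
  rw [← Complex.ofReal_natCast, ← Complex.ofReal_add, Complex.ofReal_ne_zero]
  positivity

theorem norm_inv_add_sub_le {s : ℝ} (hs : 1 / 2 ≤ s) (k : ℕ) :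
    ‖(((k + 1 : ℕ) : ℂ) + s)⁻¹ - ((k : ℂ) + s)⁻¹‖ ≤ 4 / ((k : ℝ) + 1) ^ 2 := by
  rw [inv_sub_inv (natCast_add_ne_zero hs _) (natCast_add_ne_zero hs _), div_eq_mul_inv, mul_inv,
    show (k : ℂ) + s - (((k + 1 : ℕ) : ℂ) + s) = -1 by push_cast; ring, norm_mul, norm_mul]
  have h1 := norm_inv_add_le hs k
  have h2 : ‖(((k + 1 : ℕ) : ℂ) + s)⁻¹‖ ≤ 2 / ((k : ℝ) + 1) :=
    (norm_inv_add_le hs (k + 1)).trans (by push_cast; gcongr; linarith)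
  have := mul_le_mul h2 h1 (norm_nonneg _) (by positivity)
  simp only [norm_neg, norm_one, one_mul]
  refine this.trans (le_of_eq ?_)
  rw [div_mul_div_comm, sq]
  norm_num

theorem slow_inv_add {s : ℝ} (hs : 1 / 2 ≤ s) : Slow (fun k => ((k : ℂ) + s)⁻¹) := by
  refine ⟨4, fun k => ⟨(norm_inv_add_le hs k).trans ?_, (norm_inv_add_sub_le hs k).trans ?_⟩⟩
  · rw [div_le_iff₀ (by positivity)]; linarith [(Nat.cast_nonneg k : (0 : ℝ) ≤ k)]
  · gcongr
    nlinarith [(Nat.cast_nonneg k : (0 : ℝ) ≤ k)]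

theorem Slow.pow {g : ℕ → ℂ} (hg : Slow g) (n : ℕ) : Slow (fun k => g k ^ n) := by
  induction n with
  | zero => simpa using slow_const 1
  | succ n ih => simpa [pow_succ] using ih.mul hg

/-- If `z = 1` then `q ≥ 2` and the terms are `O(1 / k ^ 2)`. If `z ≠ 1`, summation by parts applies
even for `q = 1`, since the increments of a slow sequence divided by `k + s` are `O(1 / k ^ 2)`. -/
theorem Slow.exists_hasRate {g : ℕ → ℂ} (hg : Slow g) {s : ℝ} (hs : 1 / 2 ≤ s) {q : ℕ} {z : ℂ}
    (hz : ‖z‖ = 1) (hq : 1 ≤ q) (hqz : (q, z) ≠ (1, 1)) :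
    ∃ L, HasRate (fun n => ∑ k ∈ range n, z ^ k * (g k / ((k : ℂ) + s) ^ q)) L := by
  by_cases hz1 : z = 1
  · obtain ⟨r, rfl⟩ : ∃ r, q = r + 2 := by
      refine ⟨q - 2, ?_⟩
      have : q ≠ 1 := fun h => hqz (by rw [h, hz1])
      omega
    obtain ⟨C, hC⟩ := hg.mul ((slow_inv_add hs).pow r)
    refine exists_hasRate_sum (C := 4 * C) fun k => ?_
    rw [show z ^ k * (g k / ((k : ℂ) + s) ^ (r + 2))
      = z ^ k * (g k * ((k : ℂ) + s)⁻¹ ^ r) * (((k : ℂ) + s)⁻¹ * ((k : ℂ) + s)⁻¹) by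
        rw [div_eq_mul_inv, ← inv_pow]; ring, norm_mul, norm_mul, norm_pow, hz, one_pow, one_mul,
      norm_mul (_⁻¹)]
    have h1 := norm_inv_add_le hs k
    have h2 := mul_le_mul h1 h1 (norm_nonneg _) (by positivity)
    refine (mul_le_mul (hC k).1 h2 (by positivity) ((norm_nonneg _).trans (hC 0).1)).trans
      (le_of_eq ?_)
    rw [div_mul_div_comm, ← sq, mul_div_assoc']
    ring
  · obtain ⟨r, rfl⟩ : ∃ r, q = r + 1 := ⟨q - 1, by omega⟩
    obtain ⟨C, hC⟩ := hg.mul ((slow_inv_add hs).pow r)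
    have hC0 := (norm_nonneg _).trans (hC 0).1
    have he : ∀ k : ℕ, g k / ((k : ℂ) + s) ^ (r + 1)
        = g k * ((k : ℂ) + s)⁻¹ ^ r * ((k : ℂ) + s)⁻¹ := fun k => by
      rw [div_eq_mul_inv, ← inv_pow]; ring
    -- The constant is `4 * C` from the increment of the inverse plus `2 * C` from the increment of
    -- the slow factor.
    refine exists_hasRate_sum_pow_mul (C := 6 * C) hz hz1 (fun k => ?_) (fun k => ?_)
    · rw [he, norm_mul]
      refine (mul_le_mul (hC k).1 (norm_inv_add_le hs k) (norm_nonneg _) hC0).trans ?_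
      rw [← mul_div_assoc]
      exact div_le_div_of_nonneg_right (by linarith) (by positivity)
    · rw [he, he]
      set G : ℕ → ℂ := fun k => g k * ((k : ℂ) + s)⁻¹ ^ r
      change ‖G (k + 1) * (((k + 1 : ℕ) : ℂ) + s)⁻¹ - G k * ((k : ℂ) + s)⁻¹‖ ≤ _
      rw [show G (k + 1) * (((k + 1 : ℕ) : ℂ) + s)⁻¹ - G k * ((k : ℂ) + s)⁻¹
        = G (k + 1) * ((((k + 1 : ℕ) : ℂ) + s)⁻¹ - ((k : ℂ) + s)⁻¹)
          + (G (k + 1) - G k) * ((k : ℂ) + s)⁻¹ by ring]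
      refine (norm_add_le _ _).trans ?_
      rw [norm_mul (G (k + 1)), norm_mul (G (k + 1) - G k)]
      have h1 := mul_le_mul (hC (k + 1)).1 (norm_inv_add_sub_le hs k) (norm_nonneg _) hC0
      have h2 := mul_le_mul (hC k).2 (norm_inv_add_le hs k) (norm_nonneg _) (by positivity)
      refine (add_le_add h1 h2).trans (le_of_eq ?_)
      field_simp
      ring

/-! ### Convergence of the series -/

theorem zetaN_eq (p : ℕ) (x : ℂ) (n : ℕ) :
    zetaN p x n = x * ∑ k ∈ range n, x ^ k * (1 / ((k : ℂ) + (1 : ℝ)) ^ p) := by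
  rw [zetaN, sum_Icc_one, mul_sum]
  refine sum_congr rfl fun k _ => ?_
  push_cast; ring

theorem tN_eq (p : ℕ) (x : ℂ) (n : ℕ) :
    tN p x n = x * ∑ k ∈ range n, x ^ k * (1 / ((k : ℂ) + (1 / 2 : ℝ)) ^ p) := by
  rw [tN, sum_Icc_one, mul_sum]
  refine sum_congr rfl fun k _ => ?_
  push_cast
  rw [show (k : ℂ) + 1 - 1 / 2 = k + 1 / 2 by ring]; ring

theorem eulerRPartial_eq {m : ℕ} (p : Fin m → ℕ) (q : ℕ) (x : Fin m → ℂ) (z : ℂ) (n : ℕ) :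
    eulerRPartial p q x z n
      = ∑ k ∈ range n, z ^ k * ((∏ j, zetaN (p j) (x j) k) / ((k : ℂ) + (1 / 2 : ℝ)) ^ q) := by
  rw [eulerRPartial]
  refine sum_congr rfl fun k _ => ?_
  push_cast; ring

theorem eulerSPartial_eq {m : ℕ} (p : Fin m → ℕ) (q : ℕ) (x : Fin m → ℂ) (z : ℂ) (n : ℕ) :
    eulerSPartial p q x z n = z *
      ∑ k ∈ range n, z ^ k * ((∏ j, tN (p j) (x j) (k + 1)) / ((k : ℂ) + (1 : ℝ)) ^ q) := by
  rw [eulerSPartial, sum_Icc_one, mul_sum]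
  refine sum_congr rfl fun k _ => ?_
  push_cast; ring

theorem Admissible.norm_eq_one {p : ℕ} {x : ℂ} (h : Admissible p x) : ‖x‖ = 1 :=
  h.2.1.norm_eq_one

theorem isOfFinOrder_inv {x : ℂ} (h : IsOfFinOrder x) : IsOfFinOrder x⁻¹ := by
  rw [isOfFinOrder_iff_pow_eq_one] at h ⊢
  obtain ⟨n, hn, hx⟩ := h
  exact ⟨n, hn, by rw [inv_pow, hx, inv_one]⟩

theorem Admissible.inv {p : ℕ} {x : ℂ} (h : Admissible p x) : Admissible p x⁻¹ :=
  ⟨h.1, isOfFinOrder_inv h.2.1, fun h' => h.2.2 (by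
    rw [Prod.mk.injEq, inv_eq_one] at h'; rw [h'.1, h'.2])⟩

theorem Admissible.add {p : ℕ} {x : ℂ} (h : Admissible p x) (k : ℕ) : Admissible (p + k) x :=
  ⟨h.1.trans (Nat.le_add_right p k), h.2.1, fun h' => h.2.2 (by
    rw [Prod.mk.injEq] at h'; have := h.1; rw [Prod.mk.injEq]; exact ⟨by omega, h'.2⟩)⟩

theorem HasRate.limUnder {u : ℕ → ℂ} {L : ℂ} (h : HasRate u L) :
    HasRate u (limUnder atTop u) := by rwa [h.tendsto.limUnder_eq]

theorem hasRate_zetaN {p : ℕ} {x : ℂ} (h : Admissible p x) : HasRate (zetaN p x) (Li p x) := by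
  obtain ⟨L, hL⟩ := (slow_const 1).exists_hasRate (s := 1) (by norm_num) h.norm_eq_one h.1 h.2.2
  exact HasRate.limUnder (by simpa only [← zetaN_eq] using hL.const_mul x)

theorem hasRate_tN {p : ℕ} {x : ℂ} (h : Admissible p x) : HasRate (tN p x) (ti p x) := by
  obtain ⟨L, hL⟩ := (slow_const 1).exists_hasRate (s := 1 / 2) le_rfl h.norm_eq_one h.1 h.2.2
  exact HasRate.limUnder (by simpa only [← tN_eq] using hL.const_mul x)

theorem HasRate.exists_norm_le {u : ℕ → ℂ} {L : ℂ} (h : HasRate u L) : ∃ C, ∀ n, ‖u n‖ ≤ C := by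
  obtain ⟨C, hC⟩ := h
  have hC0 : 0 ≤ C := by simpa using (norm_nonneg _).trans (hC 0)
  refine ⟨C + ‖L‖, fun n => ?_⟩
  have h1 : C / ((n : ℝ) + 1) ≤ C :=
    div_le_self hC0 (by linarith [(Nat.cast_nonneg n : (0 : ℝ) ≤ n)])
  calc ‖u n‖ = ‖(u n - L) + L‖ := by rw [sub_add_cancel]
    _ ≤ C + ‖L‖ := (norm_add_le _ _).trans (by linarith [hC n])

theorem HasRate.slow_of_sum {f : ℕ → ℂ} {x L : ℂ} {D : ℝ}
    (h : HasRate (fun n => x * ∑ k ∈ range n, f k) L) (hf : ∀ k : ℕ, ‖x * f k‖ ≤ D / (k + 1)) :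
    Slow (fun n => x * ∑ k ∈ range n, f k) := by
  obtain ⟨C, hC⟩ := h.exists_norm_le
  refine ⟨max C D, fun k => ⟨(hC k).trans (le_max_left _ _), ?_⟩⟩
  rw [← mul_sub, sum_range_succ, add_sub_cancel_left]
  refine (hf k).trans ?_
  gcongr
  exact le_max_right _ _

theorem exists_norm_le_div {s : ℝ} (hs : 1 / 2 ≤ s) {q : ℕ} (hq : 1 ≤ q) {x : ℂ} (hx : ‖x‖ = 1) :
    ∃ D, ∀ k : ℕ, ‖x * (x ^ k * (1 / ((k : ℂ) + s) ^ q))‖ ≤ D / (k + 1) := by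
  obtain ⟨r, rfl⟩ : ∃ r, q = r + 1 := ⟨q - 1, by omega⟩
  obtain ⟨C, hC⟩ := (slow_inv_add hs).pow r
  refine ⟨C * 2, fun k => ?_⟩
  rw [norm_mul, norm_mul, norm_pow, hx, one_pow, one_mul, one_mul, one_div, ← inv_pow, pow_succ,
    norm_mul, mul_div_assoc]
  exact mul_le_mul (hC k).1 (norm_inv_add_le hs k) (norm_nonneg _)
    ((norm_nonneg _).trans (hC 0).1)

/-- Convergence gives boundedness and the terms are `O(1 / n)`. Hence these partial sums, and
products of them, may serve as coefficients in `Slow.exists_hasRate`. -/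
theorem slow_zetaN {p : ℕ} {x : ℂ} (h : Admissible p x) : Slow (zetaN p x) := by
  obtain ⟨D, hD⟩ := exists_norm_le_div (s := 1) (by norm_num) h.1 h.norm_eq_one
  rw [funext (zetaN_eq p x)]
  refine HasRate.slow_of_sum (L := Li p x) ?_ hD
  rw [← funext (zetaN_eq p x)]
  exact hasRate_zetaN h

theorem slow_tN {p : ℕ} {x : ℂ} (h : Admissible p x) : Slow (tN p x) := by
  obtain ⟨D, hD⟩ := exists_norm_le_div (s := 1 / 2) le_rfl h.1 h.norm_eq_one
  rw [funext (tN_eq p x)]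
  refine HasRate.slow_of_sum (L := ti p x) ?_ hD
  rw [← funext (tN_eq p x)]
  exact hasRate_tN h

theorem hasRate_eulerRPartial {p q : ℕ} {y z : ℂ} (h : Admissible p y) (hz : Admissible q z) :
    HasRate (eulerRPartial ![p] q ![y] z) (eulerR ![p] q ![y] z) := by
  obtain ⟨L, hL⟩ := (slow_zetaN h).exists_hasRate (s := 1 / 2) le_rfl hz.norm_eq_one hz.1 hz.2.2
  refine HasRate.limUnder (L := L) ?_
  rw [funext (eulerRPartial_eq _ _ _ _)]
  simpa using hL

theorem hasRate_eulerSPartial {p q : ℕ} {y z : ℂ} (h : Admissible p y) (hz : Admissible q z) :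
    HasRate (eulerSPartial ![p] q ![y] z) (eulerS ![p] q ![y] z) := by
  obtain ⟨L, hL⟩ := (slow_tN h).shift.exists_hasRate (s := 1) (by norm_num) hz.norm_eq_one
    hz.1 hz.2.2
  refine HasRate.limUnder (L := z * L) ?_
  rw [funext (eulerSPartial_eq _ _ _ _)]
  simpa using hL.const_mul z

theorem hasRate_eulerSPartial_two {p₁ p₂ q : ℕ} {y₁ y₂ z : ℂ} (h₁ : Admissible p₁ y₁)
    (h₂ : Admissible p₂ y₂) (hz : Admissible q z) :
    HasRate (eulerSPartial ![p₁, p₂] q ![y₁, y₂] z) (eulerS ![p₁, p₂] q ![y₁, y₂] z) := by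
  obtain ⟨L, hL⟩ := ((slow_tN h₁).mul (slow_tN h₂)).shift.exists_hasRate (s := 1) (by norm_num)
    hz.norm_eq_one hz.1 hz.2.2
  refine HasRate.limUnder (L := z * L) ?_
  rw [funext (eulerSPartial_eq _ _ _ _)]
  simpa using hL.const_mul z

/-! ### Symmetric sums of rational functions over the nonzero integers. -/

section BilateralSums

/-- Symmetric partial sums over the nonzero integers. -/
noncomputable def bilateralSum (f : ℤ → ℂ) (N : ℕ) : ℂ := ∑ n ∈ Icc 1 N, (f n + f (-n))

theorem bilateralSum_succ (f : ℤ → ℂ) (N : ℕ) :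
    bilateralSum f (N + 1) = bilateralSum f N + (f (N + 1) + f (-(N + 1))) := by
  rw [bilateralSum, sum_Icc_succ_top (by omega)]
  push_cast; rfl

theorem bilateralSum_congr {f g : ℤ → ℂ} (h : ∀ n, n ≠ 0 → f n = g n) (N : ℕ) :
    bilateralSum f N = bilateralSum g N := by
  refine sum_congr rfl fun n hn => ?_
  rw [mem_Icc] at hn
  rw [h _ (by omega), h _ (by omega)]

theorem bilateralSum_add (f g : ℤ → ℂ) (N : ℕ) :
    bilateralSum (fun n => f n + g n) N = bilateralSum f N + bilateralSum g N := by
  simp only [bilateralSum, ← sum_add_distrib]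
  exact sum_congr rfl fun n _ => by ring

theorem bilateralSum_const_mul (c : ℂ) (f : ℤ → ℂ) (N : ℕ) :
    bilateralSum (fun n => c * f n) N = c * bilateralSum f N := by
  simp only [bilateralSum, mul_sum]
  exact sum_congr rfl fun n _ => by ring

theorem bilateralSum_sum {ι : Type*} (s : Finset ι) (f : ι → ℤ → ℂ) (N : ℕ) :
    bilateralSum (fun n => ∑ i ∈ s, f i n) N = ∑ i ∈ s, bilateralSum (f i) N := by
  simp only [bilateralSum]
  rw [sum_comm]
  exact sum_congr rfl fun n _ => by rw [sum_add_distrib]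

theorem bilateralSum_shift (f : ℤ → ℂ) (N : ℕ) :
    f (0 + 1) + bilateralSum (fun n => f (n + 1)) N
      = f 0 + bilateralSum f N + f (N + 1) - f (-N) := by
  induction N with
  | zero => simp [bilateralSum]
  | succ N ih =>
    rw [bilateralSum_succ, ← add_assoc, ih, bilateralSum_succ]
    push_cast
    rw [show -((N : ℤ) + 1) + 1 = -N by ring]; ring

/-- A unit shift changes a symmetric partial sum only by two boundary terms, which vanish in the
limit; no absolute convergence is needed. The omitted term at `0` has to be put back for this to
hold. -/
theorem tendsto_bilateralSum_shift {f : ℤ → ℂ} {L : ℂ}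
    (h₁ : Tendsto (fun n : ℕ => f n) atTop (𝓝 0)) (h₂ : Tendsto (fun n : ℕ => f (-n)) atTop (𝓝 0))
    (h : Tendsto (fun N => f 0 + bilateralSum f N) atTop (𝓝 L)) (a : ℕ) :
    Tendsto (fun N => f (0 + a) + bilateralSum (fun n => f (n + a)) N) atTop (𝓝 L) := by
  have hs : ∀ a : ℕ, Tendsto (fun n : ℕ => f (n + a)) atTop (𝓝 0) := fun a => by
    exact_mod_cast (tendsto_add_atTop_iff_nat a).2 h₁
  have hs' : ∀ a : ℕ, Tendsto (fun n : ℕ => f (-n + a)) atTop (𝓝 0) := fun a => by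
    rw [← tendsto_add_atTop_iff_nat a]
    simpa using h₂
  induction a with
  | zero => simpa using h
  | succ a ih =>
    have := (ih.add ((hs (a + 1)))).sub (hs' a)
    rw [add_zero, sub_zero] at this
    convert this using 2 with N
    have h3 := bilateralSum_shift (fun n => f (n + a)) N
    push_cast
    rw [show (0 : ℤ) + (a + 1) = 0 + 1 + a by ring, show (N : ℤ) + (a + 1) = N + 1 + a by ring, ← h3]
    congr 2
    funext n; congr 1; ring

theorem intCast_add_half_ne_zero (n : ℤ) (a : ℕ) : (n : ℂ) + ((a : ℂ) - 1 / 2) ≠ 0 := by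
  intro h
  have h2 : ((2 * (n + a) - 1 : ℤ) : ℂ) = 0 := by push_cast; linear_combination 2 * h
  rw [Int.cast_eq_zero] at h2
  omega

variable {x : ℂ}

theorem tN_succ (p : ℕ) (y : ℂ) (n : ℕ) :
    tN p y (n + 1) = tN p y n + y ^ (n + 1) / (((n + 1 : ℕ) : ℂ) - 1 / 2) ^ p := by
  rw [tN, sum_Icc_succ_top (by omega), ← tN]

/-- The term at `-m` belongs to the index `m + 1`, since `-m - 1/2 = -((m + 1) - 1/2)`. Hence the
factor `x⁻¹` and the cutoff `N + 1`. -/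
theorem bilateralSum_half_pow (hx : x ≠ 0) (j N : ℕ) :
    x ^ (-0 : ℤ) * (((0 : ℤ) : ℂ) - 1 / 2)⁻¹ ^ j
      + bilateralSum (fun n => x ^ (-n) * ((n : ℂ) - 1 / 2)⁻¹ ^ j) N
    = tN j x⁻¹ N + (-1) ^ j * x⁻¹ * tN j x (N + 1) := by
  induction N with
  | zero =>
    have h : (2 : ℂ) ^ j * (1 / 2) ^ j = 1 := by rw [← mul_pow]; norm_num
    simp [bilateralSum, tN]
    norm_num
    field_simp
    rw [neg_pow, mul_assoc, h, mul_one]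
  | succ N ih =>
    have hn : ((-((N : ℂ) + 1) - 1 / 2)⁻¹) ^ j = (-1) ^ j * (((N : ℂ) + 1 + 1 - 1 / 2) ^ j)⁻¹ := by
      rw [show -((N : ℂ) + 1) - 1 / 2 = -(N + 1 + 1 - 1 / 2) by ring, inv_neg, neg_pow, inv_pow]
    rw [bilateralSum_succ, ← add_assoc, ih, tN_succ j x⁻¹, tN_succ j x (N + 1)]
    push_cast
    rw [hn, neg_neg, show x ^ ((N : ℤ) + 1) = x ^ (N + 1) by exact_mod_cast zpow_natCast x (N + 1),
      zpow_neg, show x ^ ((N : ℤ) + 1) = x ^ (N + 1) by exact_mod_cast zpow_natCast x (N + 1),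
      inv_pow, inv_pow, pow_succ x (N + 1)]
    field_simp
    ring

theorem exists_norm_inv_pow_le {s : ℝ} (hs : 1 / 2 ≤ s) {q : ℕ} (hq : 1 ≤ q) :
    ∃ D, ∀ k : ℕ, ‖((k : ℂ) + s)⁻¹ ^ q‖ ≤ D / (k + 1) := by
  obtain ⟨D, hD⟩ := exists_norm_le_div hs hq (x := 1) (by simp)
  exact ⟨D, fun k => by simpa using hD k⟩

theorem tendsto_inv_pow {s : ℝ} (hs : 1 / 2 ≤ s) {q : ℕ} (hq : 1 ≤ q) :
    Tendsto (fun k : ℕ => ((k : ℂ) + s)⁻¹ ^ q) atTop (𝓝 0) := by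
  obtain ⟨D, hD⟩ := exists_norm_inv_pow_le hs hq
  exact squeeze_zero_norm hD (tendsto_const_div_succ D)

theorem tendsto_bilateralSum_half_pow (hx : IsOfFinOrder x) (i : ℕ) :
    Tendsto (fun N => x ^ (-0 : ℤ) * (((0 : ℤ) : ℂ) - 1 / 2)⁻¹ ^ (i + 1)
      + bilateralSum (fun n => x ^ (-n) * ((n : ℂ) - 1 / 2)⁻¹ ^ (i + 1)) N) atTop
      (𝓝 (-x⁻¹ * tiDiff i x)) := by
  have hx0 : x ≠ 0 := by rw [← norm_ne_zero_iff, hx.norm_eq_one]; norm_num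
  simp only [bilateralSum_half_pow hx0]
  by_cases h : (i + 1, x) = (1, 1)
  -- The two divergent sums cancel up to the single term `-1 / (N + 1/2)`, in accordance with
  -- `tiDiff 0 1 = 0`.
  · obtain ⟨h1, rfl⟩ := Prod.mk.inj h
    obtain rfl : i = 0 := by omega
    have h2 := (tendsto_inv_pow (s := 1 / 2) le_rfl le_rfl).neg (α := ℕ)
    rw [neg_zero] at h2
    rw [tiDiff_zero_one, mul_zero]
    convert h2 using 2 with N
    rw [inv_one, tN, tN, sum_Icc_succ_top (by omega)]
    push_cast
    rw [show (N : ℂ) + 1 / 2 = N + 1 - 1 / 2 by ring]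
    simp
  · have ha : Admissible (i + 1) x := ⟨by omega, hx, h⟩
    convert (hasRate_tN ha.inv).tendsto.add (((tendsto_add_atTop_iff_nat 1).2
      (hasRate_tN ha).tendsto).const_mul ((-1) ^ (i + 1) * x⁻¹)) using 2
    rw [tiDiff, pow_succ]
    field_simp
    ring

/-- The sum of `x ^ (-n) / (n + a - 1 / 2) ^ (i + 1)` over all nonzero integers `n`. -/
theorem tendsto_bilateralSum_half_shift (hx : IsOfFinOrder x) (i a : ℕ) :
    Tendsto (bilateralSum (fun n => x ^ (-n) * ((n : ℂ) + ((a : ℂ) - 1 / 2))⁻¹ ^ (i + 1))) atTop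
      (𝓝 (x ^ a * (-x⁻¹ * tiDiff i x) - ((a : ℂ) - 1 / 2)⁻¹ ^ (i + 1))) := by
  have hx1 : ‖x‖ = 1 := hx.norm_eq_one
  have hx0 : x ≠ 0 := by rw [← norm_ne_zero_iff, hx1]; norm_num
  obtain ⟨D, hD⟩ := exists_norm_inv_pow_le (s := 1 / 2) le_rfl (Nat.le_add_left 1 i)
  have h1 : Tendsto (fun n : ℕ => x ^ (-(n : ℤ)) * (((n : ℤ) : ℂ) - 1 / 2)⁻¹ ^ (i + 1)) atTop
      (𝓝 0) := by
    rw [← tendsto_add_atTop_iff_nat 1]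
    refine squeeze_zero_norm (fun n => le_of_eq_of_le ?_ (hD n)) (tendsto_const_div_succ D)
    rw [norm_mul, norm_zpow, hx1, one_zpow, one_mul]
    push_cast
    rw [show (n : ℂ) + 1 - 1 / 2 = n + 1 / 2 by ring]
  have h2 : Tendsto (fun n : ℕ => x ^ (-(-n : ℤ)) * (((-n : ℤ) : ℂ) - 1 / 2)⁻¹ ^ (i + 1)) atTop
      (𝓝 0) := by
    refine squeeze_zero_norm (fun n => le_of_eq_of_le ?_ (hD n)) (tendsto_const_div_succ D)
    rw [norm_mul, norm_zpow, hx1, one_zpow, one_mul]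
    push_cast
    rw [show -(n : ℂ) - 1 / 2 = -(n + 1 / 2) by ring, inv_neg, norm_pow, norm_neg, norm_pow]
  have h3 := ((tendsto_bilateralSum_shift
    (f := fun n : ℤ => x ^ (-n) * ((n : ℂ) - 1 / 2)⁻¹ ^ (i + 1)) h1 h2
    (tendsto_bilateralSum_half_pow hx i) a).const_mul
    (x ^ a)).sub_const (((a : ℂ) - 1 / 2)⁻¹ ^ (i + 1))
  have hxa : x ^ a * x ^ (-(a : ℤ)) = 1 := by
    rw [zpow_neg, zpow_natCast, mul_inv_cancel₀ (pow_ne_zero a hx0)]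
  refine h3.congr fun N => ?_
  rw [mul_add, ← bilateralSum_const_mul, add_sub_right_comm, add_eq_right.2]
  · refine bilateralSum_congr (fun n _ => ?_) N
    rw [neg_add, zpow_add₀ hx0]
    push_cast
    rw [add_sub_assoc]
    linear_combination (x ^ (-n) * ((n : ℂ) + ((a : ℂ) - 1 / 2))⁻¹ ^ (i + 1)) * hxa
  · rw [zero_add, ← mul_assoc, hxa]
    simp

theorem zetaN_succ (p : ℕ) (y : ℂ) (n : ℕ) :
    zetaN p y (n + 1) = zetaN p y n + y ^ (n + 1) / ((n + 1 : ℕ) : ℂ) ^ p := by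
  rw [zetaN, sum_Icc_succ_top (by omega), ← zetaN]

/-- The sum of `x ^ (-n) / n ^ (i + 1)` over all nonzero integers `n`. -/
theorem tendsto_bilateralSum_inv_pow (hx : IsOfFinOrder x) (i : ℕ) :
    Tendsto (bilateralSum (fun n => x ^ (-n) * (n : ℂ)⁻¹ ^ (i + 1))) atTop
      (𝓝 (-LiDiff i x)) := by
  have h : ∀ N, bilateralSum (fun n => x ^ (-n) * (n : ℂ)⁻¹ ^ (i + 1)) N
      = zetaN (i + 1) x⁻¹ N + (-1) ^ (i + 1) * zetaN (i + 1) x N := by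
    intro N
    induction N with
    | zero => simp [bilateralSum, zetaN]
    | succ N ih =>
      rw [bilateralSum_succ, ih, zetaN_succ, zetaN_succ]
      push_cast
      rw [neg_neg, zpow_neg,
        show x ^ ((N : ℤ) + 1) = x ^ (N + 1) by exact_mod_cast zpow_natCast x (N + 1), inv_neg,
        neg_pow ((N : ℂ) + 1)⁻¹, inv_pow, inv_pow]
      ring
  rw [funext h]
  by_cases h : (i + 1, x) = (1, 1)
  · obtain ⟨h1, rfl⟩ := Prod.mk.inj h
    obtain rfl : i = 0 := by omega
    simp [LiDiff_zero_one]
  · have ha : Admissible (i + 1) x := ⟨by omega, hx, h⟩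
    convert (hasRate_zetaN ha.inv).tendsto.add
      ((hasRate_zetaN ha).tendsto.const_mul ((-1) ^ (i + 1))) using 2
    rw [LiDiff]
    ring

/-- The weight of `n ^ (-j)` in the sum of `x ^ (-n) * R n` over all nonzero integers `n`, for a
rational function `R`; for `j = 0` it accounts for the omitted term. -/
noncomputable def zeroWeight (x : ℂ) : ℕ → ℂ
  | 0 => -1
  | i + 1 => -LiDiff i x

/-- The contribution of the pole at `1 / 2 - a` to the sum of
`x ^ (-n) / ((n + a - 1 / 2) ^ (J + 1) * n ^ (Q + 1))` over all nonzero integers `n`. -/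
noncomputable def halfPole (x : ℂ) (Q J a : ℕ) : ℂ :=
  x ^ a * ∑ i ∈ range (J + 1), (-1) ^ i * ((Q + i).choose Q : ℂ)
    * (-((a : ℂ) - 1 / 2)⁻¹) ^ (Q + 1 + i) * (-x⁻¹ * tiDiff (J - i) x)

/-- Removing from `1 / ((n + α) ^ (J + 1) * n ^ (Q + 1))` its principal part at `0` and setting `n =
0` leaves the Taylor coefficient of order `Q + 1` of `1 / (n + α) ^ (J + 1)`. It is the correction
for the omitted term `n = 0`, and explains the weight `-1` in `zeroWeight`. -/
theorem sum_choose_mul_inv_pow (c : ℂ) (J Q : ℕ) :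
    ∑ i ∈ range (J + 1), (-1) ^ i * ((Q + i).choose Q : ℂ) * (-c) ^ (Q + 1 + i) * c ^ (J + 1 - i)
      = invPowCoeff c J (Q + 1) := by
  have h : ∀ i ∈ range (J + 1), (-1) ^ i * ((Q + i).choose Q : ℂ) * (-c) ^ (Q + 1 + i)
      * c ^ (J + 1 - i) = (-1) ^ (Q + 1) * c ^ (J + 1 + (Q + 1)) * ((Q + i).choose Q : ℂ) := by
    intro i hi
    rw [mem_range] at hi
    rw [neg_pow c, show J + 1 + (Q + 1) = (Q + 1 + i) + (J + 1 - i) by omega, pow_add c,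
      pow_add (-1 : ℂ)]
    have : ((-1 : ℂ) ^ i) * (-1) ^ i = 1 := by rw [← mul_pow]; simp
    linear_combination ((-1) ^ (Q + 1) * c ^ (Q + 1 + i) * c ^ (J + 1 - i)
      * ((Q + i).choose Q : ℂ)) * this
  rw [sum_congr rfl h, ← mul_sum, ← Nat.cast_sum, sum_range_choose_add, invPowCoeff,
    show (J + (Q + 1)).choose J = (Q + 1 + J).choose (Q + 1) by
      rw [Nat.choose_symm_add, add_comm]]
  ring

theorem tendsto_bilateralSum_one_pole (hx : IsOfFinOrder x) (Q J a : ℕ) :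
    Tendsto (bilateralSum (fun n => x ^ (-n) * (((n : ℂ) + ((a : ℂ) - 1 / 2))⁻¹ ^ (J + 1)
      * (n : ℂ)⁻¹ ^ (Q + 1)))) atTop
      (𝓝 (halfPole x Q J a + ∑ k ∈ antidiagonal (Q + 1),
        invPowCoeff ((a : ℂ) - 1 / 2)⁻¹ J k.1 * zeroWeight x k.2)) := by
  have hα : (a : ℂ) - 1 / 2 ≠ 0 := by simpa using intCast_add_half_ne_zero 0 a
  set α : ℂ := (a : ℂ) - 1 / 2 with hαdef
  -- Partial fractions with `e = -α⁻¹`; the coefficients at the pole `0` are the Taylor coefficients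
  -- of the other factor.
  have hf : ∀ n : ℤ, n ≠ 0 → x ^ (-n) * (((n : ℂ) + α)⁻¹ ^ (J + 1) * (n : ℂ)⁻¹ ^ (Q + 1))
      = ∑ i ∈ range (J + 1), ((-1) ^ i * ((Q + i).choose Q : ℂ) * (-α⁻¹) ^ (Q + 1 + i))
          * (x ^ (-n) * ((n : ℂ) + α)⁻¹ ^ (J - i + 1))
        + ∑ i ∈ range (Q + 1), invPowCoeff α⁻¹ J i * (x ^ (-n) * (n : ℂ)⁻¹ ^ (Q - i + 1)) := by
    intro n hn
    have hn' : (n : ℂ) ≠ 0 := Int.cast_ne_zero.2 hn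
    have hna : (n : ℂ) + α ≠ 0 := intCast_add_half_ne_zero n a
    have h : ((n : ℂ) + α)⁻¹ * (n : ℂ)⁻¹ = -α⁻¹ * (((n : ℂ) + α)⁻¹ - (n : ℂ)⁻¹) := by
      field_simp; ring
    rw [pow_mul_pow_of_mul_eq h, mul_add, mul_sum, mul_sum, neg_neg]
    congr 1
    · refine sum_congr rfl fun i hi => ?_
      rw [mem_range] at hi
      rw [show J + 1 - i = J - i + 1 by omega]; ring
    · refine sum_congr rfl fun i hi => ?_
      rw [mem_range] at hi
      rw [show Q + 1 - i = Q - i + 1 by omega, invPowCoeff]; ring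
  have h1 := (tendsto_finsetSum (range (J + 1)) fun i _ =>
    (tendsto_bilateralSum_half_shift hx (J - i) a).const_mul
      ((-1) ^ i * ((Q + i).choose Q : ℂ) * (-α⁻¹) ^ (Q + 1 + i))).add
    (tendsto_finsetSum (range (Q + 1)) fun i _ =>
    (tendsto_bilateralSum_inv_pow hx (Q - i)).const_mul (invPowCoeff α⁻¹ J i))
  have h2 : ∑ i ∈ range (J + 1), ((-1) ^ i * ((Q + i).choose Q : ℂ) * (-α⁻¹) ^ (Q + 1 + i))
        * (x ^ a * (-x⁻¹ * tiDiff (J - i) x) - α⁻¹ ^ (J - i + 1))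
      + ∑ i ∈ range (Q + 1), invPowCoeff α⁻¹ J i * -LiDiff (Q - i) x
      = halfPole x Q J a + ∑ k ∈ antidiagonal (Q + 1), invPowCoeff α⁻¹ J k.1 * zeroWeight x k.2 := by
    rw [Nat.sum_antidiagonal_eq_sum_range_succ_mk, sum_range_succ _ (Q + 1), Nat.sub_self,
      zeroWeight, ← sum_choose_mul_inv_pow, halfPole, mul_sum]
    have e1 : ∀ i ∈ range (Q + 1), invPowCoeff α⁻¹ J i * zeroWeight x (Q + 1 - i)
        = invPowCoeff α⁻¹ J i * -LiDiff (Q - i) x := by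
      intro i hi
      rw [mem_range] at hi
      rw [show Q + 1 - i = Q - i + 1 by omega, zeroWeight]
    have e2 : ∀ i ∈ range (J + 1), ((-1) ^ i * ((Q + i).choose Q : ℂ) * (-α⁻¹) ^ (Q + 1 + i))
        * (x ^ a * (-x⁻¹ * tiDiff (J - i) x) - α⁻¹ ^ (J - i + 1))
        = x ^ a * ((-1) ^ i * ((Q + i).choose Q : ℂ) * (-α⁻¹) ^ (Q + 1 + i)
            * (-x⁻¹ * tiDiff (J - i) x))
          - (-1) ^ i * ((Q + i).choose Q : ℂ) * (-α⁻¹) ^ (Q + 1 + i) * α⁻¹ ^ (J + 1 - i) := by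
      intro i hi
      rw [mem_range] at hi
      rw [show J + 1 - i = J - i + 1 by omega]; ring
    rw [sum_congr rfl e1, sum_congr rfl e2, sum_sub_distrib]
    ring
  rw [← h2]
  refine h1.congr fun N => ?_
  rw [bilateralSum_congr hf, bilateralSum_add, bilateralSum_sum, bilateralSum_sum]
  simp only [bilateralSum_const_mul, ← hαdef]

/-- The contribution of the poles at `1 / 2 - a` and `1 / 2 - b` to the sum of
`x ^ (-n) / ((n + a - 1 / 2) ^ (P₁ + 1) * (n + b - 1 / 2) ^ (P₂ + 1) * n ^ (Q + 1))` over all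
nonzero integers `n`. -/
noncomputable def halfPoles (x : ℂ) (Q P₁ P₂ a b : ℕ) : ℂ :=
  if a = b then halfPole x Q (P₁ + P₂ + 1) a
  else ∑ i ∈ range (P₁ + 1), (-1) ^ i * ((P₂ + i).choose P₂ : ℂ)
        * ((b : ℂ) - a)⁻¹ ^ (P₂ + 1 + i) * halfPole x Q (P₁ - i) a
      + ∑ i ∈ range (P₂ + 1), (-1) ^ i * ((P₁ + i).choose P₁ : ℂ)
        * ((a : ℂ) - b)⁻¹ ^ (P₁ + 1 + i) * halfPole x Q (P₂ - i) b

/-- Equal poles merge into one of order `P₁ + P₂ + 2`. Distinct ones are first separated from each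
other, and `sum_invPowCoeff` then reassembles the contributions at `0` into a product of Taylor
coefficients, in which `a` and `b` are decoupled. -/
theorem tendsto_bilateralSum_two_poles (hx : IsOfFinOrder x) (Q P₁ P₂ a b : ℕ) :
    Tendsto (bilateralSum (fun n => x ^ (-n) * (((n : ℂ) + ((a : ℂ) - 1 / 2))⁻¹ ^ (P₁ + 1)
      * ((n : ℂ) + ((b : ℂ) - 1 / 2))⁻¹ ^ (P₂ + 1) * (n : ℂ)⁻¹ ^ (Q + 1)))) atTop
      (𝓝 (halfPoles x Q P₁ P₂ a b + ∑ k ∈ antidiagonal (Q + 1), (∑ l ∈ antidiagonal k.1,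
        invPowCoeff ((a : ℂ) - 1 / 2)⁻¹ P₁ l.1 * invPowCoeff ((b : ℂ) - 1 / 2)⁻¹ P₂ l.2)
          * zeroWeight x k.2)) := by
  by_cases hab : a = b
  · subst hab
    rw [halfPoles, if_pos rfl]
    simp only [sum_invPowCoeff_self]
    refine (tendsto_bilateralSum_one_pole hx Q (P₁ + P₂ + 1) a).congr fun N => ?_
    refine bilateralSum_congr (fun n _ => ?_) N
    ring
  have hα : (a : ℂ) - 1 / 2 ≠ 0 := by simpa using intCast_add_half_ne_zero 0 a
  have hβ : (b : ℂ) - 1 / 2 ≠ 0 := by simpa using intCast_add_half_ne_zero 0 b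
  have hne : (b : ℂ) - a ≠ 0 := sub_ne_zero.2 fun h => hab (Nat.cast_injective h).symm
  have hαβ : (a : ℂ) - 1 / 2 ≠ (b : ℂ) - 1 / 2 := fun h => hne (by linear_combination -h)
  have hf : ∀ n : ℤ, n ≠ 0 → x ^ (-n) * (((n : ℂ) + ((a : ℂ) - 1 / 2))⁻¹ ^ (P₁ + 1)
      * ((n : ℂ) + ((b : ℂ) - 1 / 2))⁻¹ ^ (P₂ + 1) * (n : ℂ)⁻¹ ^ (Q + 1))
      = ∑ i ∈ range (P₁ + 1), ((-1) ^ i * ((P₂ + i).choose P₂ : ℂ)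
          * ((b : ℂ) - a)⁻¹ ^ (P₂ + 1 + i)) * (x ^ (-n)
          * (((n : ℂ) + ((a : ℂ) - 1 / 2))⁻¹ ^ (P₁ - i + 1) * (n : ℂ)⁻¹ ^ (Q + 1)))
        + ∑ i ∈ range (P₂ + 1), ((-1) ^ i * ((P₁ + i).choose P₁ : ℂ)
          * ((a : ℂ) - b)⁻¹ ^ (P₁ + 1 + i)) * (x ^ (-n)
          * (((n : ℂ) + ((b : ℂ) - 1 / 2))⁻¹ ^ (P₂ - i + 1) * (n : ℂ)⁻¹ ^ (Q + 1))) := by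
    intro n _
    have hna := intCast_add_half_ne_zero n a
    have hnb := intCast_add_half_ne_zero n b
    have h : ((n : ℂ) + ((a : ℂ) - 1 / 2))⁻¹ * ((n : ℂ) + ((b : ℂ) - 1 / 2))⁻¹
        = ((b : ℂ) - a)⁻¹ * (((n : ℂ) + ((a : ℂ) - 1 / 2))⁻¹
          - ((n : ℂ) + ((b : ℂ) - 1 / 2))⁻¹) := by
      rw [inv_sub_inv hna hnb, eq_inv_mul_iff_mul_eq₀ hne, ← mul_inv, ← div_eq_mul_inv]
      congr 1; ring
    rw [pow_mul_pow_of_mul_eq h, ← inv_neg, neg_sub, add_mul, mul_add, sum_mul, sum_mul, mul_sum,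
      mul_sum]
    congr 1
    · refine sum_congr rfl fun i hi => ?_
      rw [mem_range] at hi
      rw [show P₁ + 1 - i = P₁ - i + 1 by omega]; ring
    · refine sum_congr rfl fun i hi => ?_
      rw [mem_range] at hi
      rw [show P₂ + 1 - i = P₂ - i + 1 by omega]; ring
  have h1 := (tendsto_finsetSum (range (P₁ + 1)) fun i _ =>
    (tendsto_bilateralSum_one_pole hx Q (P₁ - i) a).const_mul
      ((-1) ^ i * ((P₂ + i).choose P₂ : ℂ) * ((b : ℂ) - a)⁻¹ ^ (P₂ + 1 + i))).add
    (tendsto_finsetSum (range (P₂ + 1)) fun i _ =>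
    (tendsto_bilateralSum_one_pole hx Q (P₂ - i) b).const_mul
      ((-1) ^ i * ((P₁ + i).choose P₁ : ℂ) * ((a : ℂ) - b)⁻¹ ^ (P₁ + 1 + i)))
  have h2 := fun m => sum_invPowCoeff hα hβ hαβ P₁ P₂ m
  rw [halfPoles, if_neg hab]
  simp only [← h2, add_mul, sum_mul, sum_add_distrib]
  convert h1.congr (fun N => ?_) using 2
  · simp only [mul_add, sum_add_distrib, mul_sum]
    rw [sum_comm (s := antidiagonal (Q + 1)), sum_comm (s := antidiagonal (Q + 1))]
    simp only [sub_sub_sub_cancel_right, mul_assoc]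
    ring
  · rw [bilateralSum_congr hf, bilateralSum_add, bilateralSum_sum, bilateralSum_sum]
    simp only [bilateralSum_const_mul]

end BilateralSums

/-! ### Finite windows and the interchange of limits. -/

section Windows

/-- For `n ≤ M` the term is at most `(1 / n + 1 / (M - n + 1)) / M`, which leads to a Cesàro mean of
a null sequence. For `n = M + j + 1` it is `1 / ((M + j + 1) * (j + 2))`, and dominated convergence
applies. -/
theorem exists_tendsto_zero_sum_le : ∃ ε : ℕ → ℝ, Tendsto ε atTop (𝓝 0) ∧
    ∀ M N : ℕ, ∑ n ∈ Icc 1 N, 1 / ((n : ℝ) * (|(M : ℝ) - n| + 1)) ≤ ε M := by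
  have hsum : Summable fun j : ℕ => 1 / ((j : ℝ) + 1) ^ 2 := by
    exact_mod_cast (summable_nat_add_iff 1).2
      (Real.summable_one_div_nat_pow.2 (by norm_num : 1 < 2))
  have hle : ∀ M j : ℕ, 1 / (((M : ℝ) + j + 1) * (j + 2)) ≤ 1 / ((j : ℝ) + 1) ^ 2 := fun M j => by
    rw [sq]
    gcongr <;> linarith [(Nat.cast_nonneg M : (0 : ℝ) ≤ M)]
  refine ⟨fun M => 2 * ((M : ℝ)⁻¹ * ∑ i ∈ range M, 1 / ((i : ℝ) + 1))
    + ∑' j : ℕ, 1 / (((M : ℝ) + j + 1) * (j + 2)), ?_, fun M N => ?_⟩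
  · have h1 := (tendsto_one_div_add_atTop_nhds_zero_nat (𝕜 := ℝ)).cesaro.const_mul 2
    have h2 : Tendsto (fun M : ℕ => ∑' j : ℕ, 1 / (((M : ℝ) + j + 1) * (j + 2))) atTop
        (𝓝 (∑' _ : ℕ, (0 : ℝ))) := by
      refine tendsto_tsum_of_dominated_convergence hsum (fun j => ?_) (Eventually.of_forall
        fun M j => ?_)
      · refine squeeze_zero (fun M => by positivity) (fun M => ?_)
          (tendsto_one_div_add_atTop_nhds_zero_nat (𝕜 := ℝ))
        gcongr
        nlinarith [(Nat.cast_nonneg M : (0 : ℝ) ≤ M), (Nat.cast_nonneg j : (0 : ℝ) ≤ j),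
          mul_nonneg (Nat.cast_nonneg M : (0 : ℝ) ≤ M) (Nat.cast_nonneg j : (0 : ℝ) ≤ j)]
      · rw [Real.norm_of_nonneg (by positivity)]
        exact hle M j
    simpa using h1.add h2
  · have hsub : Icc 1 N ⊆ Icc 1 (M + N) := Icc_subset_Icc_right (by omega)
    refine (sum_le_sum_of_subset_of_nonneg hsub fun _ _ _ => by positivity).trans ?_
    rw [sum_Icc_one, sum_range_add]
    refine add_le_add ?_ ?_
    · have hM : ∀ i ∈ range M, 1 / (((i + 1 : ℕ) : ℝ) * (|(M : ℝ) - (i + 1 : ℕ)| + 1))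
          ≤ (M : ℝ)⁻¹ * (1 / ((i : ℝ) + 1)) + (M : ℝ)⁻¹ * (1 / (((M - 1 - i : ℕ) : ℝ) + 1)) := by
        intro i hi
        rw [mem_range] at hi
        obtain ⟨k, rfl⟩ : ∃ k, M = i + 1 + k := ⟨M - (i + 1), by omega⟩
        rw [show i + 1 + k - 1 - i = k by omega]
        push_cast
        rw [show (i : ℝ) + 1 + k - (i + 1) = k by ring, abs_of_nonneg (by positivity), ← mul_add,
          div_add_div _ _ (by positivity) (by positivity), ← div_eq_inv_mul, div_div,
          div_le_div_iff₀ (by positivity) (by positivity)]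
        have : (0 : ℝ) ≤ ((i : ℝ) + 1) * (k + 1) := by positivity
        nlinarith
      refine (sum_le_sum hM).trans (le_of_eq ?_)
      rw [sum_add_distrib, ← mul_sum, ← mul_sum, sum_range_reflect (fun i => 1 / ((i : ℝ) + 1)) M]
      ring
    · have hs : Summable fun j : ℕ => 1 / (((M : ℝ) + j + 1) * (j + 2)) :=
        Summable.of_nonneg_of_le (fun j => by positivity) (hle M) hsum
      refine le_of_eq_of_le (sum_congr rfl fun j _ => ?_)
        (hs.sum_le_tsum (range N) fun j _ => by positivity)
      push_cast
      rw [show (M : ℝ) - (M + j + 1) = -(j + 1) by ring, abs_neg, abs_of_nonneg (by positivity)]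
      ring_nf

/-- `T M n` is close to `τ n` for `n ≤ M` and to `0` for `n > M`, unless `n` is near `M`. -/
def WindowApprox (T : ℕ → ℕ → ℂ) (τ : ℕ → ℂ) : Prop :=
  ∃ C : ℝ, ∀ M n, ‖τ n‖ ≤ C ∧ ‖T M n - if n ≤ M then τ n else 0‖ ≤ C / (|(M : ℝ) - n| + 1)

theorem WindowApprox.mul {T U : ℕ → ℕ → ℂ} {τ υ : ℕ → ℂ} (hT : WindowApprox T τ)
    (hU : WindowApprox U υ) : WindowApprox (fun M n => T M n * U M n) (fun n => τ n * υ n) := by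
  obtain ⟨C, hC⟩ := hT
  obtain ⟨D, hD⟩ := hU
  have hC0 : 0 ≤ C := (norm_nonneg _).trans (hC 0 0).1
  have hD0 : 0 ≤ D := (norm_nonneg _).trans (hD 0 0).1
  -- The error of a product has three terms, each at most `C * D / d` with `d = |M - n| + 1`; in the
  -- quadratic one `d ≥ 1` absorbs a factor.
  refine ⟨3 * (C * D), fun M n => ⟨?_, ?_⟩⟩
  · rw [norm_mul]
    have := mul_le_mul (hC M n).1 (hD M n).1 (norm_nonneg _) hC0
    nlinarith [mul_nonneg hC0 hD0]
  · have hs : ‖if n ≤ M then τ n else 0‖ ≤ C := by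
      split_ifs
      · exact (hC M n).1
      · simpa using hC0
    have hs' : ‖if n ≤ M then υ n else 0‖ ≤ D := by
      split_ifs
      · exact (hD M n).1
      · simpa using hD0
    have he : (if n ≤ M then τ n * υ n else 0)
        = (if n ≤ M then τ n else 0) * (if n ≤ M then υ n else 0) := by split_ifs <;> simp
    have h1 := (hC M n).2
    have h2 := (hD M n).2
    rw [he]
    generalize (if n ≤ M then τ n else 0) = s at *
    generalize (if n ≤ M then υ n else 0) = s' at *
    set d : ℝ := |(M : ℝ) - n| + 1
    have hd : 1 ≤ d := by simp [d]
    have hD' : D / d ≤ D := div_le_self hD0 hd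
    rw [show T M n * U M n - s * s' = (T M n - s) * (U M n - s') + s * (U M n - s')
      + (T M n - s) * s' by ring]
    refine (norm_add₃_le ..).trans ?_
    rw [norm_mul, norm_mul, norm_mul]
    have h3 := mul_le_mul h1 (h2.trans hD') (norm_nonneg _) (by positivity)
    have h4 := mul_le_mul hs h2 (norm_nonneg _) hC0
    have h5 := mul_le_mul h1 hs' (norm_nonneg _) (by positivity)
    refine (add_le_add (add_le_add h3 h4) h5).trans (le_of_eq ?_)
    ring

/-- The bound is uniform in the cutoff `N ≥ M`, so `N` can go to infinity first and `M` afterwards.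
-/
theorem WindowApprox.exists_norm_sub_le {T : ℕ → ℕ → ℂ} {τ : ℕ → ℂ} (hT : WindowApprox T τ) :
    ∃ ε : ℕ → ℝ, Tendsto ε atTop (𝓝 0) ∧ ∀ w : ℕ → ℂ, (∀ n, 1 ≤ n → ‖w n‖ ≤ 1 / n) →
      ∀ M N, M ≤ N → ‖∑ n ∈ Icc 1 N, w n * T M n - ∑ n ∈ Icc 1 M, w n * τ n‖ ≤ ε M := by
  obtain ⟨C, hC⟩ := hT
  have hC0 : 0 ≤ C := (norm_nonneg _).trans (hC 0 0).1
  obtain ⟨ε, hε, h⟩ := exists_tendsto_zero_sum_le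
  refine ⟨fun M => C * ε M, by simpa using hε.const_mul C, fun w hw M N hMN => ?_⟩
  have h1 : ∑ n ∈ Icc 1 M, w n * τ n = ∑ n ∈ Icc 1 N, w n * if n ≤ M then τ n else 0 := by
    rw [← sum_subset (Icc_subset_Icc_right hMN)]
    · refine sum_congr rfl fun n hn => ?_
      rw [if_pos (mem_Icc.1 hn).2]
    · intro n hn hn'
      rw [mem_Icc] at hn hn'
      rw [if_neg (by omega), mul_zero]
  rw [h1, ← sum_sub_distrib]
  refine (norm_sum_le _ _).trans ((sum_le_sum fun n hn => ?_).trans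
    ((mul_sum _ _ C).symm.le.trans (mul_le_mul_of_nonneg_left (h M N) hC0)))
  rw [← mul_sub, norm_mul]
  refine (mul_le_mul (hw n (mem_Icc.1 hn).1) (hC M n).2 (norm_nonneg _) (by positivity)).trans
    (le_of_eq ?_)
  rw [div_mul_div_comm, one_mul, mul_one_div]

/-- A window of the series defining `ti p y`, centred at `n`. -/
noncomputable def windowSum (p : ℕ) (y : ℂ) (M : ℕ) (n : ℤ) : ℂ :=
  ∑ a ∈ Icc 1 M, y ^ a * ((n : ℂ) + ((a : ℂ) - 1 / 2))⁻¹ ^ p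

theorem windowSum_succ (p : ℕ) (y : ℂ) (M : ℕ) (n : ℤ) : windowSum p y (M + 1) n
    = windowSum p y M n + y ^ (M + 1) * ((n : ℂ) + ((M : ℂ) + 1 / 2))⁻¹ ^ p := by
  rw [windowSum, sum_Icc_succ_top (by omega), ← windowSum]
  push_cast
  rw [show (M : ℂ) + 1 - 1 / 2 = M + 1 / 2 by ring]

variable {y : ℂ}

/-- The half-integers of a window lie to the right of `0`, to the left of it, or on both sides; the
three cases are treated here and in the next two lemmas. Writing a negative one as `-(b - 1/2)`
produces the sign `(-1) ^ p`, the factor `y` and the inverse root `y⁻¹`. -/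
theorem windowSum_natCast (hy : y ≠ 0) (p M n : ℕ) :
    windowSum p y M n = y ^ (-n : ℤ) * (tN p y (n + M) - tN p y n) := by
  have hn : y ^ (-n : ℤ) * y ^ n = 1 := by
    rw [zpow_neg, zpow_natCast, inv_mul_cancel₀ (pow_ne_zero n hy)]
  induction M with
  | zero => simp [windowSum]
  | succ M ih =>
    rw [windowSum_succ, ih, ← add_assoc n M 1, tN_succ]
    push_cast
    rw [show (n : ℂ) + M + 1 - 1 / 2 = n + (M + 1 / 2) by ring, inv_pow, add_assoc n M 1, pow_add]
    linear_combination (-y ^ (M + 1) * (((n : ℂ) + (M + 1 / 2)) ^ p)⁻¹) * hn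

theorem windowSum_neg_add_left (hy : y ≠ 0) (p M k : ℕ) :
    windowSum p y M (-(M + k : ℕ))
      = y ^ (M + k) * ((-1) ^ p * y * (tN p y⁻¹ (M + k) - tN p y⁻¹ k)) := by
  induction M generalizing k with
  | zero => simp [windowSum]
  | succ M ih =>
    rw [windowSum_succ, show M + 1 + k = M + (k + 1) by ring, ih, tN_succ p y⁻¹ k]
    push_cast
    rw [show -((M : ℂ) + (k + 1)) + (M + 1 / 2) = -(k + 1 - 1 / 2) by ring, inv_neg,
      neg_pow ((k : ℂ) + 1 - 1 / 2)⁻¹, inv_pow, inv_pow]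
    field_simp
    ring

theorem windowSum_neg_add_right (hy : y ≠ 0) (p m k : ℕ) :
    windowSum p y (m + k) (-m : ℤ) = y ^ m * (tN p y k + (-1) ^ p * y * tN p y⁻¹ m) := by
  induction k with
  | zero =>
    have := windowSum_neg_add_left hy p m 0
    simpa [tN] using this
  | succ k ih =>
    rw [← add_assoc, windowSum_succ, ih, tN_succ]
    push_cast
    rw [show -(m : ℂ) + (m + k + 1 / 2) = k + 1 - 1 / 2 by ring, inv_pow, add_assoc m k 1,
      pow_add y m]
    ring

theorem windowApprox_pos {p : ℕ} (h : Admissible p y) :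
    WindowApprox (fun M n => tN p y (n + M) - tN p y n) (fun n => ti p y - tN p y n) := by
  obtain ⟨C, hC⟩ := hasRate_tN h
  have hC0 : 0 ≤ C := by simpa using (norm_nonneg _).trans (hC 0)
  refine ⟨2 * C, fun M n => ⟨?_, ?_⟩⟩
  · rw [norm_sub_rev]
    refine (hC n).trans ((div_le_self hC0 (by linarith [(Nat.cast_nonneg n : (0 : ℝ) ≤ n)])).trans
      (by linarith))
  · have h1 : ‖tN p y (n + M) - ti p y‖ ≤ C / (|(M : ℝ) - n| + 1) := by
      refine (hC _).trans ?_
      push_cast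
      gcongr
      rw [abs_le]
      constructor <;> linarith [(Nat.cast_nonneg n : (0 : ℝ) ≤ n), (Nat.cast_nonneg M : (0 : ℝ) ≤ M)]
    split_ifs with hn
    · rw [sub_sub_sub_cancel_right]
      refine h1.trans ?_
      gcongr
      linarith
    · beta_reduce
      rw [sub_zero, ← sub_sub_sub_cancel_right _ _ (ti p y), two_mul, add_div]
      refine (norm_sub_le _ _).trans (add_le_add h1 ((hC n).trans ?_))
      gcongr
      have : (M : ℝ) ≤ n := by exact_mod_cast (not_le.1 hn).le
      rw [abs_of_nonpos (by linarith)]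
      linarith [(Nat.cast_nonneg M : (0 : ℝ) ≤ M)]

/-- For `m ≤ M` the missing tail starts after `M - m`; for `m > M` the whole window lies in a tail
of the reflected series, starting after `m - M`. This is where the distance `|M - n|` in
`WindowApprox` comes from. -/
theorem windowApprox_neg {p : ℕ} (h : Admissible p y) :
    WindowApprox (fun M m => y ^ (-m : ℤ) * windowSum p y M (-m))
      (fun m => ti p y + (-1) ^ p * y * tN p y⁻¹ m) := by
  have hy : y ≠ 0 := by rw [← norm_ne_zero_iff, h.norm_eq_one]; norm_num
  obtain ⟨C, hC⟩ := hasRate_tN h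
  obtain ⟨D, hD⟩ := hasRate_tN h.inv
  obtain ⟨B, hB⟩ := (hasRate_tN h.inv).exists_norm_le
  have hC0 : 0 ≤ C := by simpa using (norm_nonneg _).trans (hC 0)
  have hD0 : 0 ≤ D := by simpa using (norm_nonneg _).trans (hD 0)
  have hB0 : 0 ≤ B := (norm_nonneg _).trans (hB 0)
  have hyn : ∀ n : ℕ, y ^ (-n : ℤ) * y ^ n = 1 := fun n => by
    rw [zpow_neg, zpow_natCast, inv_mul_cancel₀ (pow_ne_zero n hy)]
  -- The terms `‖ti p y‖ + B` bound the limit function, `C` the error for `m ≤ M` and `2 * D` the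
  -- error for `m > M`.
  refine ⟨C + 2 * D + ‖ti p y‖ + B, fun M m => ⟨?_, ?_⟩⟩
  · refine (norm_add_le _ _).trans ?_
    rw [norm_mul, norm_mul, norm_pow, norm_neg, norm_one, one_pow, h.norm_eq_one, one_mul, one_mul]
    linarith [hB m]
  · split_ifs with hm
    · obtain ⟨k, rfl⟩ := Nat.exists_eq_add_of_le hm
      beta_reduce
      rw [windowSum_neg_add_right hy, ← mul_assoc, hyn, one_mul, add_sub_add_right_eq_sub]
      refine (hC k).trans ?_
      push_cast
      rw [add_sub_cancel_left, Nat.abs_cast]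
      gcongr
      linarith [norm_nonneg (ti p y)]
    · obtain ⟨k, rfl⟩ := Nat.exists_eq_add_of_le (not_le.1 hm).le
      beta_reduce
      rw [windowSum_neg_add_left hy, ← mul_assoc, hyn, one_mul, sub_zero, norm_mul, norm_mul,
        norm_pow, norm_neg, norm_one, one_pow, h.norm_eq_one, one_mul, one_mul,
        ← sub_sub_sub_cancel_right _ _ (ti p y⁻¹)]
      push_cast
      rw [sub_add_cancel_left, abs_neg, Nat.abs_cast]
      refine (norm_sub_le _ _).trans ((add_le_add (hD _) (hD _)).trans ?_)
      have : D / (((M + k : ℕ) : ℝ) + 1) ≤ D / ((k : ℝ) + 1) := by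
        push_cast
        gcongr
        linarith [(Nat.cast_nonneg M : (0 : ℝ) ≤ M)]
      refine (add_le_add this le_rfl).trans ?_
      rw [← add_div]
      exact div_le_div_of_nonneg_right (by linarith [norm_nonneg (ti p y)]) (by positivity)

section

variable {p₁ p₂ q : ℕ} {x x₁ x₂ : ℂ}

/-- The sum over all nonzero integers `n` of `(x * x₁ * x₂) ^ (-n) / n ^ q` times the two tails,
starting after `n`, of the bilateral series extending `ti p₁ x₁` and `ti p₂ x₂`. -/
noncomputable def bilateralValue (p₁ p₂ q : ℕ) (x x₁ x₂ : ℂ) : ℂ :=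
  (ti p₁ x₁ * ti p₂ x₂ * Li q (x * x₁ * x₂)⁻¹
    - ti p₁ x₁ * eulerS ![p₂] q ![x₂] (x * x₁ * x₂)⁻¹
    - ti p₂ x₂ * eulerS ![p₁] q ![x₁] (x * x₁ * x₂)⁻¹
    + eulerS ![p₁, p₂] q ![x₁, x₂] (x * x₁ * x₂)⁻¹)
  + (-1) ^ q * (ti p₁ x₁ * ti p₂ x₂ * Li q (x * x₁ * x₂)
    + (-1) ^ p₂ * x₂ * ti p₁ x₁ * eulerS ![p₂] q ![x₂⁻¹] (x * x₁ * x₂)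
    + (-1) ^ p₁ * x₁ * ti p₂ x₂ * eulerS ![p₁] q ![x₁⁻¹] (x * x₁ * x₂)
    + (-1) ^ (p₁ + p₂) * (x₁ * x₂)
      * eulerS ![p₁, p₂] q ![x₁⁻¹, x₂⁻¹] (x * x₁ * x₂))

theorem sum_mul_mul_eq (X A B a b : ℂ) (y₁ y₂ : ℂ) (M : ℕ) :
    ∑ n ∈ Icc 1 M, X ^ n / (n : ℂ) ^ q * ((A + a * tN p₁ y₁ n) * (B + b * tN p₂ y₂ n))
      = A * B * zetaN q X M + b * (A * eulerSPartial ![p₂] q ![y₂] X M)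
        + a * (B * eulerSPartial ![p₁] q ![y₁] X M)
        + a * b * eulerSPartial ![p₁, p₂] q ![y₁, y₂] X M := by
  simp only [zetaN, eulerSPartial, mul_sum, ← sum_add_distrib]
  refine sum_congr rfl fun n _ => ?_
  simp
  ring

theorem tendsto_sum_mul_mul {X : ℂ} (A B a b : ℂ) {y₁ y₂ : ℂ} (h₁ : Admissible p₁ y₁)
    (h₂ : Admissible p₂ y₂) (hX : Admissible q X) :
    Tendsto (fun M : ℕ => ∑ n ∈ Icc 1 M, X ^ n / (n : ℂ) ^ q
      * ((A + a * tN p₁ y₁ n) * (B + b * tN p₂ y₂ n))) atTop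
      (𝓝 (A * B * Li q X + b * (A * eulerS ![p₂] q ![y₂] X) + a * (B * eulerS ![p₁] q ![y₁] X)
        + a * b * eulerS ![p₁, p₂] q ![y₁, y₂] X)) := by
  simp only [sum_mul_mul_eq]
  exact ((((hasRate_zetaN hX).tendsto.const_mul _).add
    (((hasRate_eulerSPartial h₂ hX).tendsto.const_mul _).const_mul _)).add
    (((hasRate_eulerSPartial h₁ hX).tendsto.const_mul _).const_mul _)).add
    ((hasRate_eulerSPartial_two h₁ h₂ hX).tendsto.const_mul _)

theorem tendsto_bilateralValue (hx : IsOfFinOrder x) (h₁ : Admissible p₁ x₁)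
    (h₂ : Admissible p₂ x₂) (hX : Admissible q (x * x₁ * x₂)) {R : ℕ → ℂ}
    (hR : ∀ M, Tendsto (bilateralSum fun n => x ^ (-n) * (windowSum p₁ x₁ M n
      * windowSum p₂ x₂ M n * (n : ℂ)⁻¹ ^ q)) atTop (𝓝 (R M))) :
    Tendsto R atTop (𝓝 (bilateralValue p₁ p₂ q x x₁ x₂)) := by
  have hne : ∀ {u : ℂ}, ‖u‖ = 1 → u ≠ 0 := fun hu => by rw [← norm_ne_zero_iff, hu]; norm_num
  have hx0 := hne hx.norm_eq_one
  have h10 := hne h₁.norm_eq_one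
  have h20 := hne h₂.norm_eq_one
  set X := x * x₁ * x₂ with hXdef
  have hX1 := hX.norm_eq_one
  have hnorm : ∀ n : ℕ, 1 ≤ n → ‖(n : ℂ)⁻¹ ^ q‖ ≤ 1 / n := by
    intro n hn
    rw [norm_pow, norm_inv, Complex.norm_natCast, one_div]
    exact pow_le_of_le_one (by positivity) (inv_le_one_of_one_le₀ (by exact_mod_cast hn))
      (by have := hX.1; omega)
  obtain ⟨ε, hε, hpos⟩ :=
    ((windowApprox_pos h₁).mul (windowApprox_pos h₂)).exists_norm_sub_le
  obtain ⟨ε', hε', hneg⟩ :=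
    ((windowApprox_neg h₁).mul (windowApprox_neg h₂)).exists_norm_sub_le
  have hpos' := hpos (fun n => X ^ (-n : ℤ) * (n : ℂ)⁻¹ ^ q) fun n hn => by
    rw [norm_mul, norm_zpow, hX1, one_zpow, one_mul]; exact hnorm n hn
  have hneg' := hneg (fun n => X ^ n * (-(n : ℂ))⁻¹ ^ q) fun n hn => by
    rw [norm_mul, norm_pow, hX1, one_pow, one_mul, inv_neg, norm_pow, norm_neg, ← norm_pow]
    exact hnorm n hn
  -- The powers of `x₁` and `x₂` extracted from the windows turn `x ^ (-n)` into `X ^ (-n)`.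
  have hsplit : ∀ M N, bilateralSum (fun n => x ^ (-n) * (windowSum p₁ x₁ M n
      * windowSum p₂ x₂ M n * (n : ℂ)⁻¹ ^ q)) N
      = ∑ n ∈ Icc 1 N, X ^ (-n : ℤ) * (n : ℂ)⁻¹ ^ q
          * ((tN p₁ x₁ (n + M) - tN p₁ x₁ n) * (tN p₂ x₂ (n + M) - tN p₂ x₂ n))
        + ∑ n ∈ Icc 1 N, X ^ n * (-(n : ℂ))⁻¹ ^ q * ((x₁ ^ (-n : ℤ) * windowSum p₁ x₁ M (-n))
          * (x₂ ^ (-n : ℤ) * windowSum p₂ x₂ M (-n))) := by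
    intro M N
    rw [bilateralSum, ← sum_add_distrib]
    refine sum_congr rfl fun n _ => ?_
    congr 1
    · rw [windowSum_natCast h10, windowSum_natCast h20, hXdef, mul_zpow, mul_zpow]
      push_cast
      ring
    · have e1 : x₁ ^ n * x₁ ^ (-n : ℤ) = 1 := by
        rw [zpow_neg, zpow_natCast, mul_inv_cancel₀ (pow_ne_zero n h10)]
      have e2 : x₂ ^ n * x₂ ^ (-n : ℤ) = 1 := by
        rw [zpow_neg, zpow_natCast, mul_inv_cancel₀ (pow_ne_zero n h20)]
      rw [neg_neg, zpow_natCast, hXdef, mul_pow, mul_pow]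
      push_cast
      generalize windowSum p₁ x₁ M (-n) = W₁
      generalize windowSum p₂ x₂ M (-n) = W₂
      linear_combination (-x ^ n * (-(n : ℂ))⁻¹ ^ q * W₁ * W₂ * (x₂ ^ n * x₂ ^ (-n : ℤ))) * e1
        - (x ^ n * (-(n : ℂ))⁻¹ ^ q * W₁ * W₂) * e2
  set target : ℕ → ℂ := fun M =>
    ∑ n ∈ Icc 1 M, X ^ (-n : ℤ) * (n : ℂ)⁻¹ ^ q * ((ti p₁ x₁ - tN p₁ x₁ n)
        * (ti p₂ x₂ - tN p₂ x₂ n))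
      + ∑ n ∈ Icc 1 M, X ^ n * (-(n : ℂ))⁻¹ ^ q * ((ti p₁ x₁ + (-1) ^ p₁ * x₁ * tN p₁ x₁⁻¹ n)
        * (ti p₂ x₂ + (-1) ^ p₂ * x₂ * tN p₂ x₂⁻¹ n)) with htarget
  -- The limit in `N` is taken at fixed `M`; the error bounds do not depend on `N`.
  have hbound : ∀ M, ‖R M - target M‖ ≤ ε M + ε' M := by
    intro M
    refine le_of_tendsto ((hR M).sub_const (target M)).norm ?_
    filter_upwards [eventually_ge_atTop M] with N hN
    rw [hsplit, htarget]
    simp only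
    rw [add_sub_add_comm]
    exact (norm_add_le _ _).trans (add_le_add (hpos' M N hN) (hneg' M N hN))
  have hlim : Tendsto target atTop (𝓝 (bilateralValue p₁ p₂ q x x₁ x₂)) := by
    have t1 := tendsto_sum_mul_mul (ti p₁ x₁) (ti p₂ x₂) (-1) (-1) h₁ h₂ hX.inv
    have t2 := (tendsto_sum_mul_mul (ti p₁ x₁) (ti p₂ x₂) ((-1) ^ p₁ * x₁) ((-1) ^ p₂ * x₂)
      h₁.inv h₂.inv hX).const_mul ((-1) ^ q)
    convert t1.add t2 using 2 with M
    · rw [htarget]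
      simp only
      congr 1
      · refine sum_congr rfl fun n _ => ?_
        rw [zpow_neg, zpow_natCast, inv_pow, inv_pow]
        ring
      · rw [mul_sum]
        refine sum_congr rfl fun n _ => ?_
        rw [inv_neg, neg_pow, inv_pow]
        ring
    · rw [bilateralValue, ← hXdef, pow_add]
      ring
  have hdiff : Tendsto (fun M => R M - target M) atTop (𝓝 0) :=
    squeeze_zero_norm hbound (by simpa using hε.add hε')
  simpa using hdiff.add hlim

end

end Windows

/-! ### Summing the contributions of the poles over `a` and `b`. -/

section Contributions

variable {p₁ p₂ q : ℕ} {x x₁ x₂ y z : ℂ}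

theorem sum_pow_mul_invPowCoeff (P l : ℕ) (y : ℂ) (M : ℕ) :
    ∑ a ∈ Icc 1 M, y ^ a * invPowCoeff ((a : ℂ) - 1 / 2)⁻¹ P l
      = (-1) ^ l * ((P + l).choose P : ℂ) * tN (P + 1 + l) y M := by
  rw [tN, mul_sum]
  refine sum_congr rfl fun a _ => ?_
  rw [invPowCoeff, inv_pow, div_eq_mul_inv]
  ring

/-- The contribution of the pole at `0`. -/
noncomputable def zeroPart (x x₁ x₂ : ℂ) (Q P₁ P₂ : ℕ) : ℂ :=
  ∑ k ∈ antidiagonal (Q + 1), (∑ l ∈ antidiagonal k.1,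
    ((-1) ^ l.1 * ((P₁ + l.1).choose P₁ : ℂ) * ti (P₁ + 1 + l.1) x₁)
      * ((-1) ^ l.2 * ((P₂ + l.2).choose P₂ : ℂ) * ti (P₂ + 1 + l.2) x₂)) * zeroWeight x k.2

/-- The Taylor coefficients depend on `a` and `b` separately, so the double sum factors into partial
sums of `ti`-series. -/
theorem tendsto_zeroPart {P₁ P₂ : ℕ} (Q : ℕ) (x : ℂ) (h₁ : Admissible (P₁ + 1) x₁)
    (h₂ : Admissible (P₂ + 1) x₂) :
    Tendsto (fun M : ℕ => ∑ a ∈ Icc 1 M, ∑ b ∈ Icc 1 M, x₁ ^ a * x₂ ^ b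
      * ∑ k ∈ antidiagonal (Q + 1), (∑ l ∈ antidiagonal k.1,
        invPowCoeff ((a : ℂ) - 1 / 2)⁻¹ P₁ l.1 * invPowCoeff ((b : ℂ) - 1 / 2)⁻¹ P₂ l.2)
          * zeroWeight x k.2) atTop (𝓝 (zeroPart x x₁ x₂ Q P₁ P₂)) := by
  have h : ∀ M : ℕ, ∑ a ∈ Icc 1 M, ∑ b ∈ Icc 1 M, x₁ ^ a * x₂ ^ b
      * ∑ k ∈ antidiagonal (Q + 1), (∑ l ∈ antidiagonal k.1,
        invPowCoeff ((a : ℂ) - 1 / 2)⁻¹ P₁ l.1 * invPowCoeff ((b : ℂ) - 1 / 2)⁻¹ P₂ l.2)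
          * zeroWeight x k.2
      = ∑ k ∈ antidiagonal (Q + 1), (∑ l ∈ antidiagonal k.1,
    ((-1) ^ l.1 * ((P₁ + l.1).choose P₁ : ℂ) * tN (P₁ + 1 + l.1) x₁ M)
      * ((-1) ^ l.2 * ((P₂ + l.2).choose P₂ : ℂ) * tN (P₂ + 1 + l.2) x₂ M)) * zeroWeight x k.2 := by
    intro M
    simp only [← sum_pow_mul_invPowCoeff, mul_sum, sum_mul]
    rw [sum_congr rfl fun a _ => sum_comm, sum_comm]
    refine sum_congr rfl fun k _ => ?_
    rw [sum_congr rfl fun a _ => sum_comm, sum_comm]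
    refine sum_congr rfl fun l _ => ?_
    rw [sum_comm]
    refine sum_congr rfl fun a _ => sum_congr rfl fun b _ => ?_
    ring
  simp only [h]
  exact tendsto_finsetSum _ fun k _ => (tendsto_finsetSum _ fun l _ =>
    ((hasRate_tN (h₁.add l.1)).tendsto.const_mul _).mul
      ((hasRate_tN (h₂.add l.2)).tendsto.const_mul _)).mul_const _

/-- The factor `x ^ a` hidden in `halfPole` joins `u ^ a`. For `u = x₁ * x₂` this is how the
argument `X` arises. -/
theorem pow_mul_halfPole (x u : ℂ) (Q J a : ℕ) : u ^ a * halfPole x Q J a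
    = ∑ i ∈ range (J + 1), (-1) ^ (Q + 1) * ((Q + i).choose Q : ℂ) * (-x⁻¹ * tiDiff (J - i) x)
      * ((x * u) ^ a / ((a : ℂ) - 1 / 2) ^ (Q + 1 + i)) := by
  rw [halfPole, mul_sum, mul_sum]
  refine sum_congr rfl fun i _ => ?_
  have : ((-1 : ℂ) ^ i) * (-1) ^ i = 1 := by rw [← mul_pow]; simp
  rw [neg_pow ((a : ℂ) - 1 / 2)⁻¹, inv_pow, pow_add (-1 : ℂ), mul_pow, div_eq_mul_inv]
  linear_combination ((-1) ^ (Q + 1) * ((Q + i).choose Q : ℂ) * (-x⁻¹ * tiDiff (J - i) x)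
      * (x ^ a * u ^ a * (((a : ℂ) - 1 / 2) ^ (Q + 1 + i))⁻¹)) * this

/-- The contribution of the coinciding poles at half-integers. -/
noncomputable def diagonalPart (x X : ℂ) (Q J : ℕ) : ℂ :=
  ∑ i ∈ range (J + 1), (-1) ^ (Q + 1) * ((Q + i).choose Q : ℂ) * (-x⁻¹ * tiDiff (J - i) x)
      * ti (Q + 1 + i) X

theorem tendsto_diagonalPart {Q : ℕ} (J : ℕ) {u : ℂ} (hX : Admissible (Q + 1) (x * u)) :
    Tendsto (fun M : ℕ => ∑ a ∈ Icc 1 M, u ^ a * halfPole x Q J a) atTop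
      (𝓝 (diagonalPart x (x * u) Q J)) := by
  refine (tendsto_finsetSum _ fun i _ =>
    (hasRate_tN (hX.add i)).tendsto.const_mul _).congr fun M => ?_
  simp only [pow_mul_halfPole, tN, mul_sum]
  exact sum_comm

/-- Replacing `zetaN p y (M - a)` by its limit costs a sum of terms `O(1 / (a * (M - a + 1)))`,
which tends to `0` by `exists_tendsto_zero_sum_le`. -/
theorem tendsto_sum_zetaN_sub {p q : ℕ} (hz : Admissible q z) (hy : Admissible p y) :
    Tendsto (fun M : ℕ => ∑ a ∈ Icc 1 M, z ^ a / ((a : ℂ) - 1 / 2) ^ q * zetaN p y (M - a)) atTop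
      (𝓝 (ti q z * Li p y)) := by
  obtain ⟨C, hC⟩ := hasRate_zetaN hy
  obtain ⟨D, hD⟩ := exists_norm_inv_pow_le (s := 1 / 2) le_rfl hz.1
  obtain ⟨ε, hε, h⟩ := exists_tendsto_zero_sum_le
  have hC0 : 0 ≤ C := by simpa using (norm_nonneg _).trans (hC 0)
  have hD0 : 0 ≤ D := by simpa using (norm_nonneg _).trans (hD 0)
  have h1 := (hasRate_tN hz).tendsto.mul_const (Li p y)
  have h2 : Tendsto (fun M : ℕ => ∑ a ∈ Icc 1 M, z ^ a / ((a : ℂ) - 1 / 2) ^ q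
      * (zetaN p y (M - a) - Li p y)) atTop (𝓝 0) := by
    refine squeeze_zero_norm (a := fun M => D * C * ε M) (fun M => ?_)
      (by simpa using hε.const_mul (D * C))
    refine (norm_sum_le _ _).trans ((sum_le_sum fun a ha => ?_).trans
      ((mul_sum _ _ (D * C)).symm.le.trans (mul_le_mul_of_nonneg_left (h M M) (by positivity))))
    rw [mem_Icc] at ha
    obtain ⟨b, rfl⟩ : ∃ b, a = b + 1 := ⟨a - 1, by omega⟩
    have e1 : ‖z ^ (b + 1) / (((b + 1 : ℕ) : ℂ) - 1 / 2) ^ q‖ ≤ D / ((b + 1 : ℕ) : ℝ) := by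
      rw [div_eq_mul_inv, norm_mul, norm_pow, hz.norm_eq_one, one_pow, one_mul, ← inv_pow]
      have := hD b
      push_cast at this ⊢
      rwa [show (b : ℂ) + 1 - 1 / 2 = b + 1 / 2 by ring]
    have e2 : ‖zetaN p y (M - (b + 1)) - Li p y‖ ≤ C / (|(M : ℝ) - (b + 1 : ℕ)| + 1) := by
      have := hC (M - (b + 1))
      rwa [Nat.cast_sub ha.2, ← abs_of_nonneg (a := (M : ℝ) - (b + 1 : ℕ))
        (sub_nonneg.2 (by exact_mod_cast ha.2))] at this
    rw [norm_mul]
    refine (mul_le_mul e1 e2 (norm_nonneg _) (by positivity)).trans (le_of_eq ?_)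
    rw [div_mul_div_comm, mul_one_div]
  have h3 := h1.add h2
  rw [add_zero] at h3
  refine h3.congr fun M => ?_
  rw [tN, sum_mul, ← sum_add_distrib]
  exact sum_congr rfl fun a _ => by ring

theorem tendsto_sum_zetaN_pred {p q : ℕ} (hz : Admissible q z) (hy : Admissible p y) :
    Tendsto (fun M : ℕ => ∑ a ∈ Icc 1 M, z ^ a / ((a : ℂ) - 1 / 2) ^ q * zetaN p y (a - 1)) atTop
      (𝓝 (z * eulerR ![p] q ![y] z)) := by
  refine ((hasRate_eulerRPartial hy hz).tendsto.const_mul z).congr fun M => ?_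
  rw [sum_Icc_one, eulerRPartial, mul_sum]
  refine sum_congr rfl fun a _ => ?_
  push_cast
  rw [show (a : ℂ) + 1 - 1 / 2 = a + 1 / 2 by ring]
  simp
  ring

/-- The indices `b > a` give the sum up to `M - a`, and the indices `b < a`, reflected, the sum up
to `a - 1` at `y⁻¹`. In the limit the former becomes `Li` and the latter builds an `R`-sum. -/
theorem sum_ite_pow_mul_inv_sub_pow (hy : y ≠ 0) (p : ℕ) {a M : ℕ} (ha : a ∈ Icc 1 M) :
    ∑ b ∈ Icc 1 M, (if a = b then 0 else y ^ b * ((b : ℂ) - a)⁻¹ ^ p)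
      = y ^ a * (zetaN p y (M - a) + (-1) ^ p * zetaN p y⁻¹ (a - 1)) := by
  rw [mem_Icc] at ha
  obtain ⟨s, rfl⟩ : ∃ s, a = s + 1 := ⟨a - 1, by omega⟩
  obtain ⟨k, rfl⟩ := Nat.exists_eq_add_of_le ha.2
  rw [sum_Icc_one, sum_range_add, sum_range_succ, if_pos rfl, add_zero,
    ← sum_range_reflect _ s, add_comm, Nat.add_sub_cancel_left, Nat.add_sub_cancel, zetaN, zetaN,
    sum_Icc_one, sum_Icc_one, mul_add, mul_sum, mul_sum, mul_sum]
  congr 1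
  · refine sum_congr rfl fun i _ => ?_
    rw [if_neg (by omega)]
    push_cast
    rw [show (s : ℂ) + 1 + i + 1 - (s + 1) = i + 1 by ring, inv_pow]
    ring
  · refine sum_congr rfl fun i hi => ?_
    rw [mem_range] at hi
    obtain ⟨j, rfl⟩ : ∃ j, s = i + 1 + j := ⟨s - (i + 1), by omega⟩
    rw [if_neg (by omega), show i + 1 + j - 1 - i = j by omega]
    push_cast
    rw [show (j : ℂ) + 1 - (i + 1 + j + 1) = -(i + 1) by ring, inv_neg, neg_pow, inv_pow, inv_pow]
    field_simp
    ring

/-- The contribution of the poles at the half-integers `1 / 2 - a`, `a ≠ b`. -/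
noncomputable def offDiagonalPart (x y X : ℂ) (Q P P' : ℕ) : ℂ :=
  ∑ i ∈ range (P + 1), (-1) ^ i * ((P' + i).choose P' : ℂ) * ∑ j ∈ range (P - i + 1),
    (-1) ^ (Q + 1) * ((Q + j).choose Q : ℂ) * (-x⁻¹ * tiDiff (P - i - j) x)
      * (ti (Q + 1 + j) X * Li (P' + 1 + i) y
        + (-1) ^ (P' + 1 + i) * (X * eulerR ![P' + 1 + i] (Q + 1 + j) ![y⁻¹] X))

theorem tendsto_offDiagonalPart {P' Q : ℕ} (P : ℕ) {u : ℂ} (hy : Admissible (P' + 1) y)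
    (hX : Admissible (Q + 1) (x * (u * y))) :
    Tendsto (fun M : ℕ => ∑ a ∈ Icc 1 M, ∑ b ∈ Icc 1 M, u ^ a * y ^ b * (if a = b then 0 else
      ∑ i ∈ range (P + 1), (-1) ^ i * ((P' + i).choose P' : ℂ)
        * ((b : ℂ) - a)⁻¹ ^ (P' + 1 + i) * halfPole x Q (P - i) a)) atTop
      (𝓝 (offDiagonalPart x y (x * (u * y)) Q P P')) := by
  have hy0 : y ≠ 0 := by rw [← norm_ne_zero_iff, hy.norm_eq_one]; norm_num
  have h : ∀ M : ℕ, ∑ a ∈ Icc 1 M, ∑ b ∈ Icc 1 M, u ^ a * y ^ b * (if a = b then 0 else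
      ∑ i ∈ range (P + 1), (-1) ^ i * ((P' + i).choose P' : ℂ)
        * ((b : ℂ) - a)⁻¹ ^ (P' + 1 + i) * halfPole x Q (P - i) a)
      = ∑ i ∈ range (P + 1), (-1) ^ i * ((P' + i).choose P' : ℂ) * ∑ j ∈ range (P - i + 1),
        (-1) ^ (Q + 1) * ((Q + j).choose Q : ℂ) * (-x⁻¹ * tiDiff (P - i - j) x)
        * (∑ a ∈ Icc 1 M, (x * (u * y)) ^ a / ((a : ℂ) - 1 / 2) ^ (Q + 1 + j)
            * zetaN (P' + 1 + i) y (M - a)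
          + (-1) ^ (P' + 1 + i) * ∑ a ∈ Icc 1 M, (x * (u * y)) ^ a / ((a : ℂ) - 1 / 2) ^ (Q + 1 + j)
            * zetaN (P' + 1 + i) y⁻¹ (a - 1)) := by
    intro M
    have e1 : ∀ a ∈ Icc 1 M, ∑ b ∈ Icc 1 M, u ^ a * y ^ b * (if a = b then 0 else
        ∑ i ∈ range (P + 1), (-1) ^ i * ((P' + i).choose P' : ℂ)
          * ((b : ℂ) - a)⁻¹ ^ (P' + 1 + i) * halfPole x Q (P - i) a)
        = ∑ i ∈ range (P + 1), (-1) ^ i * ((P' + i).choose P' : ℂ)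
          * (((u * y) ^ a * halfPole x Q (P - i) a)
          * (zetaN (P' + 1 + i) y (M - a) + (-1) ^ (P' + 1 + i) * zetaN (P' + 1 + i) y⁻¹ (a - 1))) := by
      intro a ha
      have e2 : ∀ b ∈ Icc 1 M, u ^ a * y ^ b * (if a = b then 0 else
        ∑ i ∈ range (P + 1), (-1) ^ i * ((P' + i).choose P' : ℂ)
          * ((b : ℂ) - a)⁻¹ ^ (P' + 1 + i) * halfPole x Q (P - i) a)
        = ∑ i ∈ range (P + 1), (-1) ^ i * ((P' + i).choose P' : ℂ) * (u ^ a * halfPole x Q (P - i) a)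
          * (if a = b then 0 else y ^ b * ((b : ℂ) - a)⁻¹ ^ (P' + 1 + i)) := by
        intro b _
        split_ifs
        · simp
        · rw [mul_sum]
          exact sum_congr rfl fun i _ => by ring
      rw [sum_congr rfl e2, sum_comm]
      refine sum_congr rfl fun i _ => ?_
      rw [← mul_sum, sum_ite_pow_mul_inv_sub_pow hy0 _ ha, mul_pow]
      ring
    rw [sum_congr rfl e1, sum_comm]
    refine sum_congr rfl fun i _ => ?_
    rw [← mul_sum]
    congr 1
    simp only [pow_mul_halfPole, sum_mul]
    rw [sum_comm]
    refine sum_congr rfl fun j _ => ?_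
    rw [mul_sum, ← sum_add_distrib, mul_sum]
    exact sum_congr rfl fun a _ => by ring
  simp only [h]
  exact tendsto_finsetSum _ fun i _ => (tendsto_finsetSum _ fun j _ =>
    ((tendsto_sum_zetaN_sub (hX.add j) (hy.add i)).add
    ((tendsto_sum_zetaN_pred (hX.add j) (hy.add i).inv).const_mul _)).const_mul _).const_mul _

/-- Both sides are limits, as `M` grows, of the same bilateral sums of products of windows. -/
theorem bilateralValue_eq {P₁ P₂ Q : ℕ} (hx : IsOfFinOrder x) (h₁ : Admissible (P₁ + 1) x₁)
    (h₂ : Admissible (P₂ + 1) x₂) (hX : Admissible (Q + 1) (x * x₁ * x₂)) :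
    bilateralValue (P₁ + 1) (P₂ + 1) (Q + 1) x x₁ x₂
      = diagonalPart x (x * x₁ * x₂) Q (P₁ + P₂ + 1)
        + offDiagonalPart x x₂ (x * x₁ * x₂) Q P₁ P₂
        + offDiagonalPart x x₁ (x * x₁ * x₂) Q P₂ P₁ + zeroPart x x₁ x₂ Q P₁ P₂ := by
  have hX₁ : x * x₁ * x₂ = x * (x₁ * x₂) := mul_assoc _ _ _
  have hX₂ : x * x₁ * x₂ = x * (x₂ * x₁) := by ring
  refine tendsto_nhds_unique (tendsto_bilateralValue hx h₁ h₂ hX (R := fun M =>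
    ∑ a ∈ Icc 1 M, ∑ b ∈ Icc 1 M, x₁ ^ a * x₂ ^ b * (halfPoles x Q P₁ P₂ a b
      + ∑ k ∈ antidiagonal (Q + 1), (∑ l ∈ antidiagonal k.1,
        invPowCoeff ((a : ℂ) - 1 / 2)⁻¹ P₁ l.1 * invPowCoeff ((b : ℂ) - 1 / 2)⁻¹ P₂ l.2)
          * zeroWeight x k.2)) fun M => ?_) ?_
  · refine (tendsto_finsetSum _ fun a _ => tendsto_finsetSum _ fun b _ =>
      (tendsto_bilateralSum_two_poles hx Q P₁ P₂ a b).const_mul _).congr fun N => ?_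
    simp only [← bilateralSum_const_mul, ← bilateralSum_sum]
    refine bilateralSum_congr (fun n _ => ?_) N
    rw [windowSum, windowSum, sum_mul_sum, sum_mul, mul_sum]
    refine sum_congr rfl fun a _ => ?_
    rw [sum_mul, mul_sum]
    exact sum_congr rfl fun b _ => by ring
  · have t1 := tendsto_diagonalPart (P₁ + P₂ + 1) (hX₁ ▸ hX)
    have t2 := tendsto_offDiagonalPart P₁ h₂ (hX₁ ▸ hX)
    have t3 := tendsto_offDiagonalPart P₂ h₁ (hX₂ ▸ hX)
    rw [← hX₁] at t1 t2
    rw [← hX₂] at t3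
    refine (((t1.add t2).add t3).add (tendsto_zeroPart Q x h₁ h₂)).congr fun M => ?_
    -- The poles at `1/2 - b` were treated with the names of the two indices exchanged.
    rw [sum_comm (γ := ℕ) (s := Icc 1 M) (t := Icc 1 M) (f := fun a b => x₂ ^ a * x₁ ^ b * _),
      ← sum_add_distrib, ← sum_add_distrib, ← sum_add_distrib]
    refine sum_congr rfl fun a ha => ?_
    -- The diagonal part is written as a double sum so that all parts can be compared term by term.
    have hd : (x₁ * x₂) ^ a * halfPole x Q (P₁ + P₂ + 1) a = ∑ b ∈ Icc 1 M, x₁ ^ a * x₂ ^ b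
        * (if a = b then halfPole x Q (P₁ + P₂ + 1) a else 0) := by
      simp only [mul_ite, mul_zero]
      rw [sum_ite_eq, if_pos ha, mul_pow]
    rw [hd, ← sum_add_distrib, ← sum_add_distrib, ← sum_add_distrib]
    refine sum_congr rfl fun b _ => ?_
    rw [halfPoles]
    by_cases hab : a = b
    · subst hab; simp; ring
    · simp only [if_neg hab, if_neg (Ne.symm hab)]; ring

end Contributions

/-! ### Matching with the explicit right-hand side. -/

theorem inv_mul_diagonalPart {P₁ P₂ Q : ℕ} {x x₁ x₂ : ℂ} :
    (x₁ * x₂)⁻¹ * diagonalPart x (x * x₁ * x₂) Q (P₁ + P₂ + 1)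
      = -((-1) ^ (Q + 1) * (x * x₁ * x₂)⁻¹ * ∑ k ∈ range (P₁ + 1 + (P₂ + 1)),
        ((P₁ + 1 + (P₂ + 1) + (Q + 1) - k - 2).choose (Q + 1 - 1) : ℂ) * tiDiff k x
          * ti (P₁ + 1 + (P₂ + 1) + (Q + 1) - k - 1) (x * x₁ * x₂)) := by
  rw [diagonalPart, ← sum_range_reflect, mul_sum, mul_sum, ← sum_neg_distrib]
  refine sum_congr (by ring_nf) fun k hk => ?_
  rw [mem_range] at hk
  rw [show P₁ + P₂ + 1 - (P₁ + P₂ + 1 + 1 - 1 - k) = k by omega,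
    show Q + (P₁ + P₂ + 1 + 1 - 1 - k) = P₁ + 1 + (P₂ + 1) + (Q + 1) - k - 2 by omega,
    show Q + 1 + (P₁ + P₂ + 1 + 1 - 1 - k) = P₁ + 1 + (P₂ + 1) + (Q + 1) - k - 1 by omega,
    Nat.add_sub_cancel, mul_inv, mul_inv, mul_inv]
  ring

/-- The substitution is `k₂ = i`, `k₁ = P - i - j`. In the `R`-term the two signs `(-1) ^ i` cancel
and `X` cancels against `X⁻¹`. -/
theorem inv_mul_offDiagonalPart {P P' Q : ℕ} {x x₁ x₂ w : ℂ} (hX : x * x₁ * x₂ ≠ 0) :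
    (x₁ * x₂)⁻¹ * offDiagonalPart x w (x * x₁ * x₂) Q P P'
      = -((-1) ^ (Q + 1) * ∑ k₁ ∈ range (P + 1), ∑ k₂ ∈ range (P + 1 - k₁),
        ((P + 1 + (Q + 1) - k₁ - k₂ - 2).choose (Q + 1 - 1) : ℂ)
          * ((k₂ + (P' + 1) - 1).choose (P' + 1 - 1) : ℂ) * tiDiff k₁ x
          * ((-1) ^ k₂ * (x * x₁ * x₂)⁻¹ * Li (k₂ + (P' + 1)) w
                * ti (Q + 1 + (P + 1) - k₁ - k₂ - 1) (x * x₁ * x₂)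
              + (-1) ^ (P' + 1) * eulerR ![k₂ + (P' + 1)] (Q + 1 + (P + 1) - k₁ - k₂ - 1) ![w⁻¹]
                (x * x₁ * x₂))) := by
  rw [sum_comm' (s' := fun k₂ => range (P + 1 - k₂)) (t' := range (P + 1))
    (fun a b => by simp only [mem_range]; omega), offDiagonalPart, mul_sum, mul_sum,
    ← sum_neg_distrib]
  refine sum_congr rfl fun i hi => ?_
  rw [mem_range] at hi
  rw [← sum_range_reflect, mul_sum, mul_sum, mul_sum, ← sum_neg_distrib]
  refine sum_congr (by congr 1; omega) fun k hk => ?_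
  rw [mem_range] at hk
  rw [show P - i - (P - i + 1 - 1 - k) = k by omega,
    show Q + (P - i + 1 - 1 - k) = P + 1 + (Q + 1) - k - i - 2 by omega,
    show Q + 1 + (P - i + 1 - 1 - k) = Q + 1 + (P + 1) - k - i - 1 by omega,
    Nat.add_sub_cancel, Nat.add_sub_cancel, show i + (P' + 1) - 1 = P' + i by omega,
    show i + (P' + 1) = P' + 1 + i by omega]
  generalize Li _ _ = L
  generalize ti _ _ = T
  generalize eulerR _ _ _ _ = R
  have hs : ((-1 : ℂ) ^ i) * (-1) ^ i = 1 := by rw [← mul_pow]; simp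
  have hX' : (x₁ * x₂)⁻¹ * x⁻¹ = (x * x₁ * x₂)⁻¹ := by rw [← mul_inv]; congr 1; ring
  have hXX : (x * x₁ * x₂)⁻¹ * (x * x₁ * x₂) = 1 := inv_mul_cancel₀ hX
  generalize (x * x₁ * x₂)⁻¹ = Y at *
  generalize x * x₁ * x₂ = X at *
  generalize ((P + 1 + (Q + 1) - k - i - 2).choose Q : ℂ) = B
  generalize ((P' + i).choose P' : ℂ) = B'
  generalize tiDiff k x = D
  rw [pow_add (-1 : ℂ) (P' + 1) i]
  linear_combination (-(-1) ^ i * B' * (-1) ^ (Q + 1) * B * D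
      * (T * L + (-1) ^ (P' + 1) * (-1) ^ i * X * R)) * hX'
    - (B' * (-1) ^ (Q + 1) * B * D * (-1) ^ (P' + 1) * R * Y * X) * hs
    - (B' * (-1) ^ (Q + 1) * B * D * (-1) ^ (P' + 1) * R) * hXX

/-- The entry of weight `zeroWeight x 0 = -1` gives the first sum, the omitted term `n = 0`; the
other entries carry `-LiDiff` and give the second. -/
theorem inv_mul_zeroPart {P₁ P₂ Q : ℕ} {x x₁ x₂ : ℂ} :
    (x₁ * x₂)⁻¹ * zeroPart x x₁ x₂ Q P₁ P₂
      = -(∑ k ∈ antidiagonal (Q + 1),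
          (-1) ^ (Q + 1) * ((P₁ + 1 + k.1 - 1).choose (P₁ + 1 - 1) : ℂ)
            * ((P₂ + 1 + k.2 - 1).choose (P₂ + 1 - 1) : ℂ)
            * (x₁ * x₂)⁻¹ * ti (P₁ + 1 + k.1) x₁ * ti (P₂ + 1 + k.2) x₂)
        - ∑ k ∈ antidiagonal (Q + 1 - 1), ∑ l ∈ antidiagonal k.2,
          LiDiff k.1 x * (-1) ^ (l.1 + l.2)
            * ((l.1 + (P₁ + 1) - 1).choose (P₁ + 1 - 1) : ℂ)
            * ((l.2 + (P₂ + 1) - 1).choose (P₂ + 1 - 1) : ℂ)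
            * ti (l.1 + (P₁ + 1)) x₁ * ti (l.2 + (P₂ + 1)) x₂ * (x₁ * x₂)⁻¹ := by
  rw [zeroPart, Nat.sum_antidiagonal_succ', mul_add, Nat.add_sub_cancel Q 1,
    ← Nat.sum_antidiagonal_swap (n := Q), sub_eq_add_neg]
  congr 1
  · simp only [zeroWeight]
    rw [sum_mul, mul_sum, ← sum_neg_distrib]
    refine sum_congr rfl fun k hk => ?_
    rw [HasAntidiagonal.mem_antidiagonal] at hk
    rw [show P₁ + 1 + k.1 - 1 = P₁ + k.1 by omega, show P₂ + 1 + k.2 - 1 = P₂ + k.2 by omega,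
      Nat.add_sub_cancel, Nat.add_sub_cancel, ← hk, pow_add (-1 : ℂ)]
    ring
  · rw [mul_sum, ← sum_neg_distrib]
    refine sum_congr rfl fun k _ => ?_
    simp only [Prod.fst_swap, Prod.snd_swap, zeroWeight]
    rw [sum_mul, mul_sum, ← sum_neg_distrib]
    refine sum_congr rfl fun l _ => ?_
    rw [show l.1 + (P₁ + 1) = P₁ + 1 + l.1 by omega, show l.2 + (P₂ + 1) = P₂ + 1 + l.2 by omega,
      show P₁ + 1 + l.1 - 1 = P₁ + l.1 by omega, show P₂ + 1 + l.2 - 1 = P₂ + l.2 by omega,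
      Nat.add_sub_cancel, Nat.add_sub_cancel, pow_add (-1 : ℂ)]
    ring

/-- The parity formula for quadratic sums. -/
theorem eulerS_parity {p₁ p₂ q : ℕ} {x x₁ x₂ : ℂ} (hx : IsOfFinOrder x) (h₁ : Admissible p₁ x₁)
    (h₂ : Admissible p₂ x₂) (hX : Admissible q (x * x₁ * x₂)) :
    (x₁ * x₂)⁻¹ * eulerS ![p₁, p₂] q ![x₁, x₂] (x * x₁ * x₂)⁻¹
        + (-1) ^ (p₁ + p₂ + q) * eulerS ![p₁, p₂] q ![x₁⁻¹, x₂⁻¹] (x * x₁ * x₂)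
      = parityRHS p₁ p₂ q x x₁ x₂ := by
  obtain ⟨P₁, rfl⟩ : ∃ P, p₁ = P + 1 := ⟨p₁ - 1, by have := h₁.1; omega⟩
  obtain ⟨P₂, rfl⟩ : ∃ P, p₂ = P + 1 := ⟨p₂ - 1, by have := h₂.1; omega⟩
  obtain ⟨Q, rfl⟩ : ∃ P, q = P + 1 := ⟨q - 1, by have := hX.1; omega⟩
  have hX0 : x * x₁ * x₂ ≠ 0 := by rw [← norm_ne_zero_iff, hX.norm_eq_one]; norm_num
  have h20 : x₂ ≠ 0 := right_ne_zero_of_mul hX0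
  have h10 : x₁ ≠ 0 := right_ne_zero_of_mul (left_ne_zero_of_mul hX0)
  -- The division removes the factor `x₁ * x₂` that reflection attached to the second quadratic sum.
  have h := congrArg (fun u => (x₁ * x₂)⁻¹ * u) (bilateralValue_eq hx h₁ h₂ hX)
  simp only [mul_add] at h
  rw [inv_mul_diagonalPart, inv_mul_offDiagonalPart hX0, inv_mul_offDiagonalPart hX0,
    inv_mul_zeroPart, bilateralValue] at h
  rw [parityRHS]
  simp only [sumSwap]
  have e12 : (x₁ * x₂)⁻¹ * (x₁ * x₂) = 1 := inv_mul_cancel₀ (mul_ne_zero h10 h20)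
  have e1 : (x₁ * x₂)⁻¹ * x₂ = x₁⁻¹ := by field_simp
  have e2 : (x₁ * x₂)⁻¹ * x₁ = x₂⁻¹ := by field_simp
  rw [pow_add (-1 : ℂ) (P₁ + 1 + (P₂ + 1))]
  linear_combination h
    - (-1) ^ (Q + 1) * (-1) ^ (P₁ + 1 + (P₂ + 1))
      * eulerS ![P₁ + 1, P₂ + 1] (Q + 1) ![x₁⁻¹, x₂⁻¹] (x * x₁ * x₂) * e12
    - (-1) ^ (Q + 1) * (-1) ^ (P₂ + 1) * ti (P₁ + 1) x₁
      * eulerS ![P₂ + 1] (Q + 1) ![x₂⁻¹] (x * x₁ * x₂) * e1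
    - (-1) ^ (Q + 1) * (-1) ^ (P₁ + 1) * ti (P₂ + 1) x₂
      * eulerS ![P₁ + 1] (Q + 1) ![x₁⁻¹] (x * x₁ * x₂) * e2

/-! ### Multiple `T`-values -/

/-- With `n₂ = m + 1` the denominator `2 n₂ - 2` becomes `2 m` and `n₁ < n₂` becomes `n₁ ≤ m`, so
the inner sum is `tN p y m`, up to a power of `2`, and the cutoff drops by one. -/
theorem multipleTPartial_two (p q : ℕ) (y z : ℂ) (N : ℕ) :
    multipleTPartial ![p, q] ![y, z] (N + 1)
      = 4 * z / 2 ^ (p + q) * eulerSPartial ![p] q ![y] z N := by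
  have h : ∑ n ∈ (Fintype.piFinset fun _ : Fin 2 => Icc 1 (N + 1)).filter (fun n => StrictMono n),
      ∏ i, ![y, z] i ^ n i / (2 * (n i : ℂ) - ((i : ℕ) + 1 : ℂ)) ^ ![p, q] i
      = ∑ s ∈ (Icc 1 N).sigma fun m => Icc 1 m,
        y ^ s.2 / (2 * (s.2 : ℂ) - 1) ^ p * (z ^ (s.1 + 1) / (2 * (s.1 : ℂ)) ^ q) := by
    refine sum_nbij' (fun n => ⟨n 1 - 1, n 0⟩) (fun s => ![s.2, s.1 + 1]) ?_ ?_ ?_ ?_ ?_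
    · intro n hn
      simp [Fin.strictMono_iff_lt_succ, Fin.forall_fin_two] at hn
      simp
      omega
    · rintro ⟨m, k⟩ hs
      simp at hs
      simp [Fin.strictMono_iff_lt_succ, Fin.forall_fin_two]
      omega
    · intro n hn
      simp [Fin.strictMono_iff_lt_succ, Fin.forall_fin_two] at hn
      funext i
      fin_cases i
      · rfl
      · simp; omega
    · rintro ⟨m, k⟩ hs
      simp
    · intro n hn
      simp [Fin.strictMono_iff_lt_succ, Fin.forall_fin_two] at hn
      obtain ⟨m, hm⟩ : ∃ m, n 1 = m + 1 := ⟨n 1 - 1, by omega⟩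
      rw [Fin.prod_univ_two]
      simp [hm]
      exact Or.inl (by ring)
  rw [multipleTPartial]
  convert congrArg (fun u => (2 : ℂ) ^ 2 * u) h using 1
  rw [sum_sigma, eulerSPartial, mul_sum, mul_sum]
  refine sum_congr rfl fun m _ => ?_
  simp only [univ_unique, prod_singleton, Matrix.cons_val_fin_one, tN]
  rw [sum_div, sum_mul, mul_sum, mul_sum]
  refine sum_congr rfl fun k _ => ?_
  rw [show 2 * (k : ℂ) - 1 = 2 * (k - 1 / 2) by ring, mul_pow, mul_pow, pow_add, pow_succ]
  ring

theorem tN_sub_tN (r : ℕ) (w : ℂ) {m N : ℕ} (h : m ≤ N) :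
    ∑ l ∈ Icc (m + 1) N, w ^ l / ((l : ℂ) - 1 / 2) ^ r = tN r w N - tN r w m := by
  induction N, h using Nat.le_induction with
  | base => simp
  | succ N hN ih => rw [sum_Icc_succ_top (by omega), ih, tN_succ]; ring

/-- Moreover `n₃ = l + 1` turns `2 n₃ - 3` into `2 l - 1` and `n₂ < n₃` into `m < l`, so the sum
over `l` is a difference of two values of `tN`; this separates into a product and a quadratic sum.
-/
theorem multipleTPartial_three (p q r : ℕ) (y z w : ℂ) (N : ℕ) :
    multipleTPartial ![p, q, r] ![y, z, w] (N + 1)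
      = 8 * (z * w) / 2 ^ (p + q + r) * (tN r w N * eulerSPartial ![p] q ![y] z N
        - eulerSPartial ![p, r] q ![y, w] z N) := by
  have h : ∑ n ∈ (Fintype.piFinset fun _ : Fin 3 => Icc 1 (N + 1)).filter (fun n => StrictMono n),
      ∏ i, ![y, z, w] i ^ n i / (2 * (n i : ℂ) - ((i : ℕ) + 1 : ℂ)) ^ ![p, q, r] i
      = ∑ s ∈ (Icc 1 N).sigma fun m => Icc 1 m ×ˢ Icc (m + 1) N,
        y ^ s.2.1 / (2 * (s.2.1 : ℂ) - 1) ^ p * (z ^ (s.1 + 1) / (2 * (s.1 : ℂ)) ^ q)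
          * (w ^ (s.2.2 + 1) / (2 * (s.2.2 : ℂ) - 1) ^ r) := by
    refine sum_nbij' (fun n => ⟨n 1 - 1, (n 0, n 2 - 1)⟩)
      (fun s => ![s.2.1, s.1 + 1, s.2.2 + 1]) ?_ ?_ ?_ ?_ ?_
    · intro n hn
      simp [Fin.strictMono_iff_lt_succ, Fin.forall_fin_succ] at hn
      simp
      omega
    · rintro ⟨m, k, l⟩ hs
      simp at hs
      simp [Fin.strictMono_iff_lt_succ, Fin.forall_fin_succ]
      omega
    · intro n hn
      simp [Fin.strictMono_iff_lt_succ, Fin.forall_fin_succ] at hn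
      funext i
      fin_cases i
      · rfl
      · simp; omega
      · simp; omega
    · rintro ⟨m, k, l⟩ hs
      simp
    · intro n hn
      simp [Fin.strictMono_iff_lt_succ, Fin.forall_fin_succ] at hn
      obtain ⟨m, hm⟩ : ∃ m, n 1 = m + 1 := ⟨n 1 - 1, by omega⟩
      obtain ⟨l, hl⟩ : ∃ l, n 2 = l + 1 := ⟨n 2 - 1, by omega⟩
      rw [Fin.prod_univ_three]
      simp [hm, hl]
      ring_nf
  rw [multipleTPartial]
  convert congrArg (fun u => (2 : ℂ) ^ 3 * u) h using 1
  rw [sum_sigma, eulerSPartial, eulerSPartial, mul_sum, ← sum_sub_distrib, mul_sum, mul_sum]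
  refine sum_congr rfl fun m hm => ?_
  have hw : ∑ s ∈ Icc 1 m ×ˢ Icc (m + 1) N,
        y ^ s.1 / (2 * (s.1 : ℂ) - 1) ^ p * (z ^ (m + 1) / (2 * (m : ℂ)) ^ q)
          * (w ^ (s.2 + 1) / (2 * (s.2 : ℂ) - 1) ^ r)
      = tN p y m / 2 ^ p * (z ^ (m + 1) / (2 * (m : ℂ)) ^ q)
        * (w / 2 ^ r * (tN r w N - tN r w m)) := by
    rw [← tN_sub_tN r w (mem_Icc.1 hm).2, sum_product, tN, sum_div, sum_mul, sum_mul]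
    refine sum_congr rfl fun k _ => ?_
    rw [mul_sum, mul_sum]
    refine sum_congr rfl fun l _ => ?_
    rw [show 2 * (k : ℂ) - 1 = 2 * (k - 1 / 2) by ring,
      show 2 * (l : ℂ) - 1 = 2 * (l - 1 / 2) by ring, mul_pow 2 ((k : ℂ) - 1 / 2),
      mul_pow 2 ((l : ℂ) - 1 / 2), pow_succ w]
    ring
  rw [hw]
  simp only [univ_unique, prod_singleton, Matrix.cons_val_fin_one, Fin.prod_univ_two,
    Matrix.cons_val_zero, Matrix.cons_val_one]
  rw [mul_pow, pow_add, pow_add, pow_succ z]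
  ring

theorem tendsto_multipleTPartial_two {p q : ℕ} {y z : ℂ} (h : Admissible p y)
    (hz : Admissible q z) : Tendsto (multipleTPartial ![p, q] ![y, z]) atTop
      (𝓝 (4 * z / 2 ^ (p + q) * eulerS ![p] q ![y] z)) := by
  rw [← tendsto_add_atTop_iff_nat 1]
  simp only [multipleTPartial_two]
  exact (hasRate_eulerSPartial h hz).tendsto.const_mul _

theorem tendsto_multipleTPartial_three {p q r : ℕ} {y z w : ℂ} (h : Admissible p y)
    (hz : Admissible q z) (hw : Admissible r w) :
    Tendsto (multipleTPartial ![p, q, r] ![y, z, w]) atTop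
      (𝓝 (8 * (z * w) / 2 ^ (p + q + r)
        * (ti r w * eulerS ![p] q ![y] z - eulerS ![p, r] q ![y, w] z))) := by
  rw [← tendsto_add_atTop_iff_nat 1]
  simp only [multipleTPartial_three]
  exact (((hasRate_tN hw).tendsto.mul (hasRate_eulerSPartial h hz).tendsto).sub
    (hasRate_eulerSPartial_two h hw hz).tendsto).const_mul _

theorem multipleT_two {p q : ℕ} {y z : ℂ} (h : Admissible p y) (hz : Admissible q z) :
    multipleT ![p, q] ![y, z] = 4 * z / 2 ^ (p + q) * eulerS ![p] q ![y] z :=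
  (tendsto_multipleTPartial_two h hz).limUnder_eq

theorem multipleT_three {p q r : ℕ} {y z w : ℂ} (h : Admissible p y) (hz : Admissible q z)
    (hw : Admissible r w) : multipleT ![p, q, r] ![y, z, w] = 8 * (z * w) / 2 ^ (p + q + r)
      * (ti r w * eulerS ![p] q ![y] z - eulerS ![p, r] q ![y, w] z) :=
  (tendsto_multipleTPartial_three h hz hw).limUnder_eq

/-- The parity formula for triple `T`-values. -/
theorem multipleT_parity {p₁ p₂ q : ℕ} {x x₁ x₂ : ℂ} (hx : IsOfFinOrder x)
    (h₁ : Admissible p₁ x₁) (h₂ : Admissible p₂ x₂) (hX : Admissible q (x * x₁ * x₂)) :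
    2 ^ (p₁ + p₂ + q) / 8 *
        (x * x₂⁻¹ * multipleT ![p₁, q, p₂] ![x₁, (x * x₁ * x₂)⁻¹, x₂]
          + (-1) ^ (p₁ + p₂ + q) * (x * x₁)⁻¹
              * multipleT ![p₁, q, p₂] ![x₁⁻¹, x * x₁ * x₂, x₂⁻¹])
      = 2 ^ (p₁ + q) / 4 *
          (x * ti p₂ x₂ * multipleT ![p₁, q] ![x₁, (x * x₁ * x₂)⁻¹]
            + (-1) ^ (p₁ + p₂ + q) * (x * x₁ * x₂)⁻¹ * ti p₂ x₂⁻¹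
                * multipleT ![p₁, q] ![x₁⁻¹, x * x₁ * x₂])
        - parityRHS p₁ p₂ q x x₁ x₂ := by
  -- The products of `ti` with linear sums cancel against the double values; what remains is minus
  -- the left-hand side of the quadratic parity formula.
  rw [multipleT_three h₁ hX.inv h₂, multipleT_three h₁.inv hX h₂.inv, multipleT_two h₁ hX.inv,
    multipleT_two h₁.inv hX, ← eulerS_parity hx h₁ h₂ hX, show p₁ + q + p₂ = p₁ + p₂ + q by ring]
  have hX0 : x * x₁ * x₂ ≠ 0 := by rw [← norm_ne_zero_iff, hX.norm_eq_one]; norm_num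
  have h20 : x₂ ≠ 0 := right_ne_zero_of_mul hX0
  have h10 : x₁ ≠ 0 := right_ne_zero_of_mul (left_ne_zero_of_mul hX0)
  have hx0 : x ≠ 0 := left_ne_zero_of_mul (left_ne_zero_of_mul hX0)
  generalize eulerS _ _ _ _ = S₁
  generalize eulerS _ _ _ _ = S₂
  generalize eulerS _ _ _ _ = S₃
  generalize eulerS _ _ _ _ = S₄
  generalize ti _ _ = T₁
  generalize ti _ _ = T₂
  field_simp
  ring

end CyclotomicEuler

theorem mainTheorem6 :
    -- all series that occur converge
    (∀ (p : ℕ) (y : ℂ), Admissible p y → Converges (zetaN p y) ∧ Converges (tN p y)) ∧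
    (∀ (p q : ℕ) (y z : ℂ), Admissible p y → Admissible q z →
      Converges (eulerRPartial ![p] q ![y] z) ∧
      Converges (eulerSPartial ![p] q ![y] z) ∧
      Converges (multipleTPartial ![p, q] ![y, z])) ∧
    (∀ (p₁ p₂ q : ℕ) (y₁ y₂ z : ℂ), Admissible p₁ y₁ → Admissible p₂ y₂ → Admissible q z →
      Converges (eulerSPartial ![p₁, p₂] q ![y₁, y₂] z) ∧
      Converges (multipleTPartial ![p₁, q, p₂] ![y₁, z, y₂])) ∧
    -- the parity formula for quadratic sums
    (∀ (p₁ p₂ q : ℕ) (x x₁ x₂ : ℂ), 1 ≤ p₁ → 1 ≤ p₂ → 1 ≤ q →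
      IsOfFinOrder x → IsOfFinOrder x₁ → IsOfFinOrder x₂ →
      (p₁, x₁) ≠ (1, 1) → (p₂, x₂) ≠ (1, 1) → (q, x * x₁ * x₂) ≠ (1, 1) →
      (x₁ * x₂)⁻¹ * eulerS ![p₁, p₂] q ![x₁, x₂] (x * x₁ * x₂)⁻¹
        + (-1) ^ (p₁ + p₂ + q) * eulerS ![p₁, p₂] q ![x₁⁻¹, x₂⁻¹] (x * x₁ * x₂)
      = parityRHS p₁ p₂ q x x₁ x₂) ∧
    -- double and triple `T`-values in terms of linear and quadratic sums
    (∀ (p q : ℕ) (y z : ℂ), Admissible p y → Admissible q z →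
      multipleT ![p, q] ![y, z] = 4 * z / 2 ^ (p + q) * eulerS ![p] q ![y] z) ∧
    (∀ (p q r : ℕ) (y z w : ℂ), Admissible p y → Admissible q z → Admissible r w →
      multipleT ![p, q, r] ![y, z, w] =
        8 * (z * w) / 2 ^ (p + q + r)
          * (ti r w * eulerS ![p] q ![y] z - eulerS ![p, r] q ![y, w] z)) ∧
    -- the resulting parity formula for triple `T`-values
    (∀ (p₁ p₂ q : ℕ) (x x₁ x₂ : ℂ), 1 ≤ p₁ → 1 ≤ p₂ → 1 ≤ q →
      IsOfFinOrder x → IsOfFinOrder x₁ → IsOfFinOrder x₂ →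
      (p₁, x₁) ≠ (1, 1) → (p₂, x₂) ≠ (1, 1) → (q, x * x₁ * x₂) ≠ (1, 1) →
      2 ^ (p₁ + p₂ + q) / 8 *
        (x * x₂⁻¹ * multipleT ![p₁, q, p₂] ![x₁, (x * x₁ * x₂)⁻¹, x₂]
          + (-1) ^ (p₁ + p₂ + q) * (x * x₁)⁻¹
              * multipleT ![p₁, q, p₂] ![x₁⁻¹, x * x₁ * x₂, x₂⁻¹])
      = 2 ^ (p₁ + q) / 4 *
          (x * ti p₂ x₂ * multipleT ![p₁, q] ![x₁, (x * x₁ * x₂)⁻¹]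
            + (-1) ^ (p₁ + p₂ + q) * (x * x₁ * x₂)⁻¹ * ti p₂ x₂⁻¹
                * multipleT ![p₁, q] ![x₁⁻¹, x * x₁ * x₂])
        - parityRHS p₁ p₂ q x x₁ x₂) := by
  refine ⟨fun p y h => ⟨⟨_, (hasRate_zetaN h).tendsto⟩, ⟨_, (hasRate_tN h).tendsto⟩⟩,
    fun p q y z h hz => ⟨⟨_, (hasRate_eulerRPartial h hz).tendsto⟩,
      ⟨_, (hasRate_eulerSPartial h hz).tendsto⟩, ⟨_, tendsto_multipleTPartial_two h hz⟩⟩,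
    fun p₁ p₂ q y₁ y₂ z h₁ h₂ hz => ⟨⟨_, (hasRate_eulerSPartial_two h₁ h₂ hz).tendsto⟩,
      ⟨_, tendsto_multipleTPartial_three h₁ hz h₂⟩⟩,
    fun p₁ p₂ q x x₁ x₂ hp₁ hp₂ hq hx hx₁ hx₂ h₁ h₂ hX =>
      eulerS_parity hx ⟨hp₁, hx₁, h₁⟩ ⟨hp₂, hx₂, h₂⟩ ⟨hq, (hx.mul hx₁).mul hx₂, hX⟩,
    fun p q y z h hz => multipleT_two h hz,
    fun p q r y z w h hz hw => multipleT_three h hz hw,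
    fun p₁ p₂ q x x₁ x₂ hp₁ hp₂ hq hx hx₁ hx₂ h₁ h₂ hX =>
      multipleT_parity hx ⟨hp₁, hx₁, h₁⟩ ⟨hp₂, hx₂, h₂⟩ ⟨hq, (hx.mul hx₁).mul hx₂, hX⟩⟩
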